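/- All graphs are finite, simple and have at least one vertex; $e(H)$ denotes the number of edges of $H$. An edge colouring of a graph $G$ (with any set of colours) is proper if any two distinct edges sharing a vertex receive distinct colours, and a (not necessarily induced) copy of $H$ in an edge-coloured graph $G$ is rainbow if all its edges have distinct colours. The degree anti-Ramsey number $AR_d(H)$ of a graph $H$ is the smallest integer $k$ for which there exists a graph $G$ with maximum degree at most $k$ such that every proper edge colouring of $G$ yields a rainbow copy of $H$. Theorem. Let $F$ be a forest. Then $AR_d(F) = e(F) - 1$, unless $F$ is a star $K_{1,t}$ of any size $t \ge 0$ or a matching with precisely two edges, in either case possibly together with isolated vertices; in these exceptional cases $AR_d(F) = e(F)$. (In particular, $AR_d(F)$ exists for every forest $F$.) -/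

import Mathlib

namespace DegreeAntiRamsey

open SimpleGraph

/-- A proper edge colouring of `G` with colours in `K`: distinct edges that share a vertex get
distinct colours, i.e. a proper vertex colouring of the line graph of `G`. -/
abbrev ProperEdgeColouring {W : Type*} (G : SimpleGraph W) (K : Type*) :=
  G.lineGraph.Coloring K

/-- The edge coloured graph `(G, c)` contains a rainbow copy of `H`: a (not necessarily induced)
copy of `H` in `G` whose edges have pairwise distinct colours. -/
def HasRainbowCopy {V W K : Type*} (H : SimpleGraph V) (G : SimpleGraph W)
    (c : ProperEdgeColouring G K) : Prop :=
  ∃ f : Copy H G, Function.Injective fun e : H.edgeSet => c (f.mapEdgeSet e)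

/-- There is a finite graph `G` of maximum degree at most `k` such that every proper edge
colouring of `G`, with any set of colours, yields a rainbow copy of `H`. -/
def ForcedAtDegree {V : Type*} (H : SimpleGraph V) (k : ℕ) : Prop :=
  ∃ (W : Type) (_ : Fintype W) (G : SimpleGraph W) (_ : DecidableRel G.Adj),
    G.maxDegree ≤ k ∧
      ∀ (K : Type) (c : ProperEdgeColouring G K), HasRainbowCopy H G c

/-- `k` is the degree anti-Ramsey number of `H`: the smallest integer `k` for which there exists
a graph of maximum degree at most `k` each of whose proper edge colourings yields a rainbow copy
of `H`. Existence of such an integer is part of this predicate. -/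
def IsDegreeAntiRamseyNumber {V : Type*} (H : SimpleGraph V) (k : ℕ) : Prop :=
  IsLeast {k : ℕ | ForcedAtDegree H k} k

/-- `F` is a star `K_{1,t}` with `t ≥ 0` edges, possibly together with `m ≥ 0` isolated
vertices. -/
def IsStarWithIsolated {V : Type*} (F : SimpleGraph V) : Prop :=
  ∃ t m : ℕ, Nonempty (F ≃g starGraph (0 : Fin (t + 1)) ⊕g (⊥ : SimpleGraph (Fin m)))

/-- `F` is a matching with precisely two edges, possibly together with `m ≥ 0` isolated
vertices. -/
def IsTwoMatchingWithIsolated {V : Type*} (F : SimpleGraph V) : Prop :=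
  ∃ m : ℕ, Nonempty
    (F ≃g (completeGraph (Fin 2) ⊕g completeGraph (Fin 2)) ⊕g (⊥ : SimpleGraph (Fin m)))

end DegreeAntiRamsey

/-! Lower bounds. By Vizing's theorem (`nonempty_properEdgeColouring`) a graph of maximum degree at
most `k` has a proper edge colouring with `k + 1` colours, so a rainbow copy of `F` forces `e(F) ≤ k
+ 1`. For a star the image of the centre already has degree at least `e(F)`; for two disjoint edges,
a graph of maximum degree at most one can be coloured with a single colour.

Upper bound. Let `F` be non-exceptional and `k = e(F) - 1`, so `k ≥ 2`. In a `k`-regular graph a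
rainbow forest can be grown edge by edge while at most `k - 1` colours are in use, since the `k`
edges at a vertex have distinct colours. Only the last edge is critical: `k` colours are taken, and
one of them must be absent at the vertex `v` where that edge is attached. The last edge is chosen to
be a leaf edge `vl`. As `F` is not a star, some edge avoids `v`; the embedding starts with `v` and
such an edge, placed so that its colour does not occur at the image of `v`
(`exists_isRainbowOn_seed`).

This start requires a regular graph in which no proper edge colouring gives all adjacent vertices
the same set of colours. It comes from a parity obstruction: `k` copies of a Cayley graph each lose
one edge, and the loose ends are joined to two new vertices so that both ends of one copy meet the
same new vertex (`exists_colourAt_ne_of_glue`). Components of `F` are sent to disjoint copies of the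
graph. Within a component, injectivity follows from the absence of short cycles: two vertices with
the same image would give a short walk joining the ends of an edge and, by the rainbow property,
avoiding that edge (`IsRainbowOn.injective`). -/

namespace DegreeAntiRamsey

open SimpleGraph

/-! ### Vizing's theorem by fans and Kempe components. -/

section Vizing

variable {V K : Type*}

/-- In a graph of maximum degree at most two, no component contains three vertices of degree at
most one. -/
lemma not_reachable_of_three_ends [Fintype V] (G : SimpleGraph V) [DecidableRel G.Adj]
    (h2 : ∀ v, G.degree v ≤ 2) {x y z : V} (hxy : x ≠ y) (hxz : x ≠ z) (hyz : y ≠ z)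
    (hx : G.degree x ≤ 1) (hy : G.degree y ≤ 1) (hz : G.degree z ≤ 1) :
    ¬ (G.Reachable x y ∧ G.Reachable x z) := by
  classical
  rintro ⟨hry, hrz⟩
  set C := G.connectedComponentMk x with hC
  have hxC : x ∈ C := rfl
  have hyC : y ∈ C := ConnectedComponent.sound hry.symm
  have hzC : z ∈ C := ConnectedComponent.sound hrz.symm
  have : DecidableRel C.toSimpleGraph.Adj := Classical.decRel _
  have hdeg : ∀ v : C, C.toSimpleGraph.degree v ≤ G.degree v := by
    intro v
    rw [← card_neighborFinset_eq_degree, ← card_neighborFinset_eq_degree]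
    refine Finset.card_le_card_of_injOn (fun w => (w : V)) ?_ (fun a _ b _ h => Subtype.ext h)
    intro w hw
    simp only [Finset.mem_coe, mem_neighborFinset] at hw ⊢
    exact hw
  have hcard := C.connected_toSimpleGraph.card_vert_le_card_edgeSet_add_one
  have hsum := C.toSimpleGraph.sum_degrees_eq_twice_card_edges
  rw [Nat.card_eq_fintype_card, Nat.card_eq_fintype_card, ← edgeFinset_card] at hcard
  set T : Finset C := {⟨x, hxC⟩, ⟨y, hyC⟩, ⟨z, hzC⟩} with hT
  have hT3 : T.card = 3 := by
    rw [hT, Finset.card_eq_three]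
    exact ⟨_, _, _, by simpa using hxy, by simpa using hxz, by simpa using hyz, rfl⟩
  have hind : ∑ v : C, (if v ∈ T then 1 else 0) = 3 := by
    rw [Finset.sum_ite_mem, Finset.univ_inter, Finset.sum_const, hT3, smul_eq_mul]
  -- The three ends push the degree sum of the component down to at most `2|C| - 3`, whereas
  -- connectedness forces at least `|C| - 1` edges.
  have hle : ∑ v : C, (C.toSimpleGraph.degree v + if v ∈ T then 1 else 0) ≤ ∑ v : C, 2 := by
    refine Finset.sum_le_sum fun v _ => ?_
    have := hdeg v
    split_ifs with hv
    · simp only [hT, Finset.mem_insert, Finset.mem_singleton] at hv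
      rcases hv with rfl | rfl | rfl <;> simp only at this <;> omega
    · have := h2 v
      omega
  rw [Finset.sum_add_distrib, hind, hsum, Finset.sum_const, smul_eq_mul, Finset.card_univ] at hle
  omega

/-- A partial proper edge colouring of the complete graph on `V`. -/
structure IsPartialColouring (c : Sym2 V → Option K) : Prop where
  loopless : ∀ u, c s(u, u) = none
  proper : ∀ {u v w k}, c s(u, v) = some k → c s(u, w) = some k → v = w

/-- No edge at `v` has colour `k`. -/
def Missing (c : Sym2 V → Option K) (v : V) (k : K) : Prop :=
  ∀ w, c s(v, w) ≠ some k

/-- The graph of edges coloured `α` or `β`. -/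
def kempeGraph (c : Sym2 V → Option K) (α β : K) : SimpleGraph V where
  Adj u v := u ≠ v ∧ (c s(u, v) = some α ∨ c s(u, v) = some β)
  symm := ⟨fun u v h => by rw [Sym2.eq_swap]; exact ⟨h.1.symm, h.2⟩⟩
  loopless := ⟨fun _ h => h.1 rfl⟩

open Classical in
/-- Exchange the colours `α` and `β` on the edges meeting `C`. -/
noncomputable def kempeSwap (c : Sym2 V → Option K) (α β : K) (C : Set V) (e : Sym2 V) :
    Option K :=
  if ∃ v ∈ e, v ∈ C then (c e).map (Equiv.swap α β) else c e

lemma kempeGraph_degree_le [Fintype V] {c : Sym2 V → Option K} (hc : IsPartialColouring c)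
    (α β : K) [DecidableRel (kempeGraph c α β).Adj] (v : V) :
    (kempeGraph c α β).degree v ≤ 2 := by
  classical
  rw [← card_neighborFinset_eq_degree]
  refine (Finset.card_le_card_of_injOn (t := {some α, some β}) (fun w => c s(v, w)) ?_ ?_).trans
    Finset.card_le_two
  · intro w hw
    simp only [Finset.mem_coe, mem_neighborFinset] at hw
    simpa using hw.2
  · intro w hw w' hw' h
    simp only [Finset.mem_coe, mem_neighborFinset] at hw hw'
    rcases hw.2 with h1 | h1
    · exact hc.proper h1 (by rw [← h1]; exact h.symm)
    · exact hc.proper h1 (by rw [← h1]; exact h.symm)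

lemma kempeGraph_degree_le_one [Fintype V] {c : Sym2 V → Option K} (hc : IsPartialColouring c)
    {α β : K} [DecidableRel (kempeGraph c α β).Adj] {v : V}
    (h : Missing c v α ∨ Missing c v β) : (kempeGraph c α β).degree v ≤ 1 := by
  rw [← card_neighborFinset_eq_degree, Finset.card_le_one]
  intro w hw w' hw'
  simp only [mem_neighborFinset] at hw hw'
  rcases h with h | h
  · exact hc.proper (hw.2.resolve_left (h _)) (hw'.2.resolve_left (h _))
  · exact hc.proper (hw.2.resolve_right (h _)) (hw'.2.resolve_right (h _))

section Swap

variable {c : Sym2 V → Option K} {α β : K} {C : Set V}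

-- An edge with exactly one end in the closed set `C` is coloured neither `α` nor `β`, so the
-- exchange leaves it alone. Hence it suffices to test one end of the edge, and either end will do.
open Classical in
lemma kempeSwap_apply
    (hC : ∀ u v, u ∈ C → (kempeGraph c α β).Adj u v → v ∈ C) (u v : V) :
    kempeSwap c α β C s(u, v) =
      if u ∈ C then (c s(u, v)).map (Equiv.swap α β) else c s(u, v) := by
  by_cases hu : u ∈ C
  · simp [kempeSwap, hu]
  · by_cases hv : v ∈ C
    · have huv : u ≠ v := by rintro rfl; exact hu hv
      have h : ¬ (c s(u, v) = some α ∨ c s(u, v) = some β) := fun h =>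
        hu (hC v u hv ⟨huv.symm, by rwa [Sym2.eq_swap]⟩)
      push Not at h
      simp only [kempeSwap, Sym2.mem_iff, hu, if_false]
      rw [if_pos ⟨v, Or.inr rfl, hv⟩]
      cases hk : c s(u, v) with
      | none => rfl
      | some k =>
        rw [hk] at h
        simp only [ne_eq, Option.some.injEq] at h
        simp [Equiv.swap_apply_of_ne_of_ne h.1 h.2]
    · simp [kempeSwap, hu, hv]

lemma IsPartialColouring.kempeSwap (hc : IsPartialColouring c)
    (hC : ∀ u v, u ∈ C → (kempeGraph c α β).Adj u v → v ∈ C) :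
    IsPartialColouring (kempeSwap c α β C) := by
  classical
  constructor
  · intro u
    rw [kempeSwap_apply hC, hc.loopless]
    simp
  · intro u v w k hv hw
    rw [kempeSwap_apply hC] at hv hw
    split_ifs at hv hw with h
    · simp only [Option.map_eq_some_iff] at hv hw
      obtain ⟨a, ha, ha'⟩ := hv
      obtain ⟨b, hb, hb'⟩ := hw
      obtain rfl : a = b := (Equiv.swap α β).injective (ha'.trans hb'.symm)
      exact hc.proper ha hb
    · exact hc.proper hv hw

lemma kempeSwap_isSome (e : Sym2 V) : (kempeSwap c α β C e).isSome = (c e).isSome := by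
  unfold DegreeAntiRamsey.kempeSwap
  split_ifs <;> simp

lemma missing_kempeSwap_of_notMem
    (hC : ∀ u v, u ∈ C → (kempeGraph c α β).Adj u v → v ∈ C) {v : V} (hv : v ∉ C) {k : K} :
    Missing (kempeSwap c α β C) v k ↔ Missing c v k := by
  classical
  unfold Missing
  simp only [kempeSwap_apply hC, hv, if_false]

lemma missing_kempeSwap_of_mem [DecidableEq K]
    (hC : ∀ u v, u ∈ C → (kempeGraph c α β).Adj u v → v ∈ C) {v : V} (hv : v ∈ C) {k : K} :
    Missing (kempeSwap c α β C) v k ↔ Missing c v (Equiv.swap α β k) := by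
  classical
  unfold Missing
  simp only [kempeSwap_apply hC, hv, if_true, ne_eq, Option.map_eq_some_iff, not_exists, not_and]
  refine forall_congr' fun w => ⟨fun h h' => h _ h' ?_, fun h a ha hak => h ?_⟩
  · convert Equiv.swap_apply_self α β k
  · rw [ha, ← hak]
    congr 1
    convert (Equiv.swap_apply_self α β a).symm

end Swap

/-- A colour missing at `u` occurs on the edge from `x` to `u'`. -/
def FanStep (c : Sym2 V → Option K) (x u u' : V) : Prop :=
  ∃ γ, c s(x, u') = some γ ∧ Missing c u γ

/-- Whenever a step returns to an earlier vertex, the chain is cut back to that vertex. -/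
lemma exists_nodup_isChain {α : Type*} {r : α → α → Prop} {a b : α}
    (h : Relation.ReflTransGen r a b) :
    ∃ l : List α, (a :: l).IsChain r ∧ (a :: l).Nodup ∧ (a :: l).getLast (by simp) = b := by
  induction h with
  | refl => exact ⟨[], by simp⟩
  | @tail b b' _ hbc ih =>
    obtain ⟨l, h1, h2, h3⟩ := ih
    by_cases hmem : b' ∈ a :: l
    · obtain ⟨s, t, hst⟩ := List.append_of_mem hmem
      rcases s with _ | ⟨a', s⟩
      · simp only [List.nil_append, List.cons.injEq] at hst
        exact ⟨[], by simp [hst.1]⟩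
      · have hst' : a :: l = (a' :: (s ++ [b'])) ++ t := by rw [hst]; simp
        obtain rfl : a = a' := by simp at hst; exact hst.1
        refine ⟨s ++ [b'], ?_, ?_, by simp⟩
        · rw [hst'] at h1
          exact h1.left_of_append
        · rw [hst'] at h2
          exact (List.nodup_append.1 h2).1
    · refine ⟨l ++ [b'], ?_, ?_, by simp⟩
      · rw [← List.cons_append, List.isChain_append]
        refine ⟨h1, by simp, ?_⟩
        intro u hu v hv
        simp only [List.head?_cons, Option.mem_def, Option.some.injEq] at hv
        rw [List.getLast?_eq_some_getLast (by simp)] at hu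
        simp only [Option.mem_def, Option.some.injEq] at hu
        rw [← hu, ← hv, h3]
        exact hbc
      · rw [← List.cons_append, List.nodup_append]
        refine ⟨h2, by simp, ?_⟩
        intro u hu v hv huv
        simp only [List.mem_singleton] at hv
        exact hmem (hv ▸ huv ▸ hu)

/-- Rotation of the fan: `xy` receives the colour of the next fan edge, which is missing at `y`, and
that next edge becomes the uncoloured one. At the end of the fan, `α` is missing at both ends of the
uncoloured edge. -/
lemma exists_extension_of_isChain [DecidableEq V] {x : V} {α : K} (l : List V) :
    ∀ (y : V) (c : Sym2 V → Option K), IsPartialColouring c → x ≠ y → c s(x, y) = none →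
      (y :: l).IsChain (FanStep c x) → (y :: l).Nodup → Missing c x α →
      Missing c ((y :: l).getLast (by simp)) α →
      ∃ c' : Sym2 V → Option K, IsPartialColouring c' ∧
        ∀ e, (c' e).isSome ↔ ((c e).isSome ∨ e = s(x, y)) := by
  induction l with
  | nil =>
    intro y c hc hxy hy _ _ hx hlast
    simp only [List.getLast_singleton] at hlast
    have key : ∀ {u v k}, Function.update c s(x, y) (some α) s(u, v) = some k →
        (s(u, v) = s(x, y) ∧ k = α) ∨ c s(u, v) = some k := by
      intro u v k h
      by_cases he : s(u, v) = s(x, y)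
      · rw [he, Function.update_self] at h
        exact Or.inl ⟨he, (Option.some.inj h).symm⟩
      · rw [Function.update_of_ne he] at h
        exact Or.inr h
    refine ⟨Function.update c s(x, y) (some α), ⟨?_, ?_⟩, ?_⟩
    · intro u
      rw [Function.update_of_ne, hc.loopless]
      rw [Ne, Sym2.eq_iff]
      rintro (⟨rfl, h⟩ | ⟨rfl, h⟩)
      · exact hxy h
      · exact hxy h.symm
    · intro u v w k h1 h2
      rcases key h1 with ⟨e1, k1⟩ | e1 <;> rcases key h2 with ⟨e2, k2⟩ | e2
      · rw [← e2, Sym2.congr_right] at e1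
        exact e1
      · subst k1
        rcases Sym2.eq_iff.1 e1 with ⟨rfl, rfl⟩ | ⟨rfl, rfl⟩
        · exact absurd e2 (hx w)
        · exact absurd e2 (hlast w)
      · subst k2
        rcases Sym2.eq_iff.1 e2 with ⟨rfl, rfl⟩ | ⟨rfl, rfl⟩
        · exact absurd e1 (hx v)
        · exact absurd e1 (hlast v)
      · exact hc.proper e1 e2
    · intro e
      by_cases he : e = s(x, y)
      · simp [he]
      · simp [he]
  | cons y₁ l ih =>
    intro y c hc hxy hy hchain hnodup hx hlast
    rw [List.isChain_cons_cons] at hchain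
    obtain ⟨⟨γ, hγ, hmiss⟩, hchain⟩ := hchain
    have hyy₁ : y ≠ y₁ := by
      rintro rfl
      simp at hnodup
    have hy_notMem : y ∉ y₁ :: l := (List.nodup_cons.1 hnodup).1
    have hxy₁ : x ≠ y₁ := by
      rintro rfl
      simp [hc.loopless] at hγ
    have hne : s(x, y) ≠ s(x, y₁) := by
      rw [Ne, Sym2.congr_right]
      exact hyy₁
    set c₁ := Function.update (Function.update c s(x, y₁) none) s(x, y) (some γ) with hc₁
    have hc₁y : c₁ s(x, y) = some γ := Function.update_self ..
    have hc₁y₁ : c₁ s(x, y₁) = none := by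
      rw [hc₁, Function.update_of_ne hne.symm, Function.update_self]
    have hc₁e : ∀ e, e ≠ s(x, y) → e ≠ s(x, y₁) → c₁ e = c e := fun e h h' => by
      rw [hc₁, Function.update_of_ne h, Function.update_of_ne h']
    have key : ∀ {u v k}, c₁ s(u, v) = some k →
        (s(u, v) = s(x, y) ∧ k = γ) ∨ (s(u, v) ≠ s(x, y₁) ∧ c s(u, v) = some k) := by
      intro u v k h
      by_cases he : s(u, v) = s(x, y)
      · rw [he, hc₁y] at h
        exact Or.inl ⟨he, (Option.some.inj h).symm⟩
      · by_cases he' : s(u, v) = s(x, y₁)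
        · rw [he', hc₁y₁] at h
          exact absurd h (by simp)
        · rw [hc₁e _ he he'] at h
          exact Or.inr ⟨he', h⟩
    have hmiss₁ : ∀ {u k}, u ≠ x → u ≠ y → Missing c u k → Missing c₁ u k := by
      intro u k hux huy h w hw
      rcases key hw with ⟨h1, -⟩ | ⟨-, h1⟩
      · rcases Sym2.eq_iff.1 h1 with ⟨rfl, rfl⟩ | ⟨rfl, rfl⟩
        · exact hux rfl
        · exact huy rfl
      · exact h w h1
    have hpc : IsPartialColouring c₁ := by
      refine ⟨?_, ?_⟩
      · intro u
        rw [hc₁e, hc.loopless]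
        · rw [Ne, Sym2.eq_iff]
          rintro (⟨rfl, h⟩ | ⟨rfl, h⟩)
          · exact hxy h
          · exact hxy h.symm
        · rw [Ne, Sym2.eq_iff]
          rintro (⟨rfl, h⟩ | ⟨rfl, h⟩)
          · exact hxy₁ h
          · exact hxy₁ h.symm
      · have aux : ∀ {u v w}, s(u, v) = s(x, y) → s(u, w) ≠ s(x, y₁) → c s(u, w) = some γ →
            False := by
          intro u v w h1 h2 h3
          rcases Sym2.eq_iff.1 h1 with ⟨rfl, rfl⟩ | ⟨rfl, rfl⟩
          · exact h2 (by rw [hc.proper h3 hγ])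
          · exact hmiss w h3
        intro u v w k h1 h2
        rcases key h1 with ⟨e1, k1⟩ | ⟨n1, e1⟩ <;> rcases key h2 with ⟨e2, k2⟩ | ⟨n2, e2⟩
        · rw [← e2, Sym2.congr_right] at e1
          exact e1
        · subst k1
          exact (aux e1 n2 e2).elim
        · subst k2
          exact (aux e2 n1 e1).elim
        · exact hc.proper e1 e2
    have hmem_ne : ∀ u ∈ y₁ :: l, u ≠ y := by
      rintro u hu rfl
      exact hy_notMem hu
    have hmem_ne_x : ∀ u ∈ y₁ :: l, u ≠ x := by
      intro u hu
      rcases List.mem_cons.1 hu with rfl | hul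
      · exact hxy₁.symm
      · rintro rfl
        obtain ⟨s, t, hst⟩ := List.append_of_mem hul
        rw [hst, ← List.cons_append, List.isChain_append] at hchain
        obtain ⟨δ, hδ, -⟩ := hchain.2.2 _ (List.getLast?_eq_some_getLast (by simp)) u (by simp)
        simp [hc.loopless] at hδ
    have hchain₁ : (y₁ :: l).IsChain (FanStep c₁ x) := by
      have hnd := (List.nodup_cons.1 hnodup).2
      have hl : ∀ u ∈ l, u ≠ y₁ := by
        rintro u hu rfl
        exact (List.nodup_cons.1 hnd).1 hu
      rw [List.isChain_iff_getElem] at hchain ⊢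
      intro i hi
      obtain ⟨δ, hδ, hm⟩ := hchain i hi
      refine ⟨δ, ?_, hmiss₁ (hmem_ne_x _ (List.getElem_mem _)) (hmem_ne _ (List.getElem_mem _)) hm⟩
      rw [hc₁e, hδ]
      · rw [Ne, Sym2.congr_right]
        exact hmem_ne _ (List.getElem_mem _)
      · rw [Ne, Sym2.congr_right]
        exact hl _ (by simp [List.getElem_cons_succ])
    have hx₁ : Missing c₁ x α := by
      intro w hw
      rcases key hw with ⟨-, rfl⟩ | ⟨-, h1⟩
      · exact hx _ hγ
      · exact hx w h1
    rw [List.getLast_cons (by simp)] at hlast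
    obtain ⟨c', hc', hdom⟩ := ih y₁ c₁ hpc hxy₁ hc₁y₁ hchain₁ (List.nodup_cons.1 hnodup).2 hx₁
      (hmiss₁ (hmem_ne_x _ (List.getLast_mem _)) (hmem_ne _ (List.getLast_mem _)) hlast)
    refine ⟨c', hc', fun e => ?_⟩
    rw [hdom]
    by_cases he : e = s(x, y)
    · simp [he, hc₁y]
    · by_cases he' : e = s(x, y₁)
      · simp [he', hγ]
      · rw [hc₁e e he he']
        simp [he, he']

/-- The inductive step of Vizing's theorem: if no fan can be rotated directly, two fan vertices miss
the same colour, and a Kempe exchange away from `x` makes a rotation possible. -/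
lemma exists_extension [Fintype V] {c : Sym2 V → Option K} (hc : IsPartialColouring c)
    (hmiss : ∀ v, ∃ k, Missing c v k) {x y : V} (hxy : x ≠ y) (hy : c s(x, y) = none) :
    ∃ c' : Sym2 V → Option K, IsPartialColouring c' ∧
      ∀ e, (c' e).isSome ↔ ((c e).isSome ∨ e = s(x, y)) := by
  classical
  have of_fan : ∀ {c : Sym2 V → Option K} {u : V} {α : K}, IsPartialColouring c →
      c s(x, y) = none → Missing c x α → Relation.ReflTransGen (FanStep c x) y u →
      Missing c u α → ∃ c' : Sym2 V → Option K, IsPartialColouring c' ∧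
        ∀ e, (c' e).isSome ↔ ((c e).isSome ∨ e = s(x, y)) := by
    intro c u α hc hy hx hR hu
    obtain ⟨l, h1, h2, h3⟩ := exists_nodup_isChain hR
    exact exists_extension_of_isChain l y c hc hxy hy h1 h2 hx (by rwa [h3])
  by_contra hno
  obtain ⟨α, hα⟩ := hmiss x
  set R : Finset V := {u | Relation.ReflTransGen (FanStep c x) y u} with hR
  have hyR : y ∈ R := by simp [hR, Relation.ReflTransGen.refl]
  choose β hβ using hmiss
  -- If `β u` were missing at `x` too, rotating the fan up to `u` would colour `xy`.
  have hpres : ∀ u ∈ R, ∃ w, c s(x, w) = some (β u) := by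
    intro u hu
    by_contra h
    push Not at h
    exact hno (of_fan hc hy h (by simpa [hR] using hu) (hβ u))
  choose! g hg using hpres
  -- The end `g u` of the edge coloured `β u` is again in the fan, and it is not `y` because `xy` is
  -- uncoloured. The pigeonhole principle then yields two fan vertices missing the same colour.
  have hmaps : ∀ u ∈ R, g u ∈ R.erase y := by
    intro u hu
    refine Finset.mem_erase.2 ⟨?_, ?_⟩
    · intro h
      have := hg u hu
      rw [h, hy] at this
      exact absurd this (by simp)
    · have h : Relation.ReflTransGen (FanStep c x) y u := by simpa [hR] using hu
      simpa [hR] using h.tail ⟨β u, hg u hu, hβ u⟩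
  obtain ⟨u, hu, u', hu', huu', hgu⟩ := Finset.exists_ne_map_eq_of_card_lt_of_maps_to
    (Finset.card_erase_lt_of_mem hyR) hmaps
  have hββ : β u = β u' := by
    have h1 := hg u hu
    rw [hgu, hg u' hu'] at h1
    exact (Option.some.inj h1).symm
  have hne_x : ∀ v ∈ R, v ≠ x := by
    rintro v hv rfl
    have h : Relation.ReflTransGen (FanStep c v) y v := by simpa [hR] using hv
    rcases Relation.ReflTransGen.cases_tail h with h | ⟨w, -, δ, hδ, -⟩
    · exact hxy h
    · simp [hc.loopless] at hδ
  -- one of the two vertices missing a common colour is not in the Kempe component of `x`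
  obtain ⟨v, hv, hβv, hvx⟩ : ∃ v ∈ R, β v = β u ∧ ¬ (kempeGraph c α (β u)).Reachable v x := by
    by_contra hcon
    push Not at hcon
    exact not_reachable_of_three_ends (kempeGraph c α (β u))
      (kempeGraph_degree_le hc α (β u)) (hne_x u hu).symm (hne_x u' hu').symm huu'
      (kempeGraph_degree_le_one hc (Or.inl hα)) (kempeGraph_degree_le_one hc (Or.inr (hβ u)))
      (kempeGraph_degree_le_one hc (Or.inr (hββ ▸ hβ u')))
      ⟨(hcon u hu rfl).symm, (hcon u' hu' hββ.symm).symm⟩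
  set b := β u with hb
  set C : Set V := {w | (kempeGraph c α b).Reachable v w} with hCdef
  have hC : ∀ w w', w ∈ C → (kempeGraph c α b).Adj w w' → w' ∈ C :=
    fun w w' hw hadj => Reachable.trans hw hadj.reachable
  have hxC : x ∉ C := hvx
  set c₁ := kempeSwap c α b C with hc₁
  have hpc₁ : IsPartialColouring c₁ := hc.kempeSwap hC
  have hxc₁ : ∀ w, c₁ s(x, w) = c s(x, w) := fun w => by
    rw [hc₁, kempeSwap_apply hC, if_neg hxC]
  have hα₁ : Missing c₁ x α := (missing_kempeSwap_of_notMem hC hxC).2 hα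
  -- The exchange keeps the colours at `x`, so a fan step can only break at a vertex of `C` whose
  -- relevant missing colour was `b`. After the exchange that vertex misses `α`, and the fan may
  -- stop there.
  have hclaim : ∀ w, Relation.ReflTransGen (FanStep c x) y w →
      Relation.ReflTransGen (FanStep c₁ x) y w ∨
        ∃ z, Relation.ReflTransGen (FanStep c₁ x) y z ∧ Missing c₁ z α := by
    intro w hw
    induction hw with
    | refl => exact Or.inl .refl
    | @tail w w' _ hstep ih =>
      rcases ih with ih | ih
      · obtain ⟨γ, hγ, hm⟩ := hstep
        by_cases hm₁ : Missing c₁ w γ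
        · exact Or.inl (ih.tail ⟨γ, by rw [hxc₁, hγ], hm₁⟩)
        · right
          refine ⟨w, ih, ?_⟩
          have hwC : w ∈ C := by
            by_contra h
            exact hm₁ ((missing_kempeSwap_of_notMem hC h).2 hm)
          have hγα : γ ≠ α := by
            rintro rfl
            exact hα _ hγ
          have hγb : γ = b := by
            by_contra h
            refine hm₁ ((missing_kempeSwap_of_mem hC hwC).2 ?_)
            rwa [Equiv.swap_apply_of_ne_of_ne hγα h]
          refine (missing_kempeSwap_of_mem hC hwC).2 ?_
          rwa [Equiv.swap_apply_left, ← hγb]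
      · exact Or.inr ih
  have hvC : v ∈ C := Reachable.refl v
  have hvα : Missing c₁ v α := by
    refine (missing_kempeSwap_of_mem hC hvC).2 ?_
    rw [Equiv.swap_apply_left, ← hβv]
    exact hβ v
  obtain ⟨z, hz, hzα⟩ : ∃ z, Relation.ReflTransGen (FanStep c₁ x) y z ∧ Missing c₁ z α := by
    rcases hclaim v (by simpa [hR] using hv) with h | h
    · exact ⟨v, h, hvα⟩
    · exact h
  obtain ⟨c', hc', hdom⟩ := of_fan hpc₁ (by rw [hxc₁, hy]) hα₁ hz hzα
  exact hno ⟨c', hc', fun e => by rw [hdom, hc₁, kempeSwap_isSome]⟩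

/-- **Vizing's theorem**: a finite simple graph whose degrees are smaller than the number of
colours has a proper edge colouring. -/
theorem nonempty_properEdgeColouring [Fintype V] [Fintype K] (G : SimpleGraph V)
    [DecidableRel G.Adj] (h : ∀ v, G.degree v < Fintype.card K) :
    Nonempty (ProperEdgeColouring G K) := by
  classical
  have key : ∀ E : Finset (Sym2 V), (E : Set (Sym2 V)) ⊆ G.edgeSet →
      ∃ c : Sym2 V → Option K, IsPartialColouring c ∧ ∀ e, (c e).isSome ↔ e ∈ E := by
    intro E
    induction E using Finset.induction_on with
    | empty =>
      intro _
      exact ⟨fun _ => none, ⟨fun _ => rfl, by simp⟩, by simp⟩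
    | insert e E he ih =>
      intro hE
      obtain ⟨c, hc, hdom⟩ := ih fun e' he' => hE (by simp [Finset.mem_coe.1 he'])
      have hadj : ∀ v w k, c s(v, w) = some k → G.Adj v w := by
        intro v w k hk
        have : s(v, w) ∈ E := (hdom _).1 (by simp [hk])
        exact hE (Finset.mem_coe.2 (Finset.mem_insert_of_mem this))
      have hmiss : ∀ v, ∃ k, Missing c v k := by
        intro v
        by_contra hcon
        unfold Missing at hcon
        push Not at hcon
        choose w hw using hcon
        have hinj : Function.Injective w := by
          intro k k' hkk
          have h1 := hw k
          rw [hkk, hw k'] at h1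
          exact (Option.some.inj h1).symm
        have : Fintype.card K ≤ G.degree v := by
          rw [← card_neighborFinset_eq_degree, ← Finset.card_univ]
          refine Finset.card_le_card_of_injOn w ?_ hinj.injOn
          intro k _
          simpa using hadj _ _ _ (hw k)
        exact absurd this (not_le.2 (h v))
      induction e with | _ x y
      have hxy : G.Adj x y := hE (Finset.mem_coe.2 (Finset.mem_insert_self _ _))
      obtain ⟨c', hc', hdom'⟩ := exists_extension hc hmiss hxy.ne
        (by
          rw [← Option.not_isSome_iff_eq_none, hdom]
          exact he)
      refine ⟨c', hc', fun e => ?_⟩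
      rw [hdom', hdom, Finset.mem_insert, or_comm]
  obtain ⟨c, hc, hdom⟩ := key G.edgeFinset (by simp)
  have hs : ∀ e : G.edgeSet, (c e).isSome := fun e => (hdom e).2 (by simp)
  refine ⟨Coloring.mk (fun e => (c e).get (hs e)) ?_⟩
  intro e e' hadj heq
  rw [lineGraph_adj_iff_exists] at hadj
  obtain ⟨hne, v, hv, hv'⟩ := hadj
  obtain ⟨w, hw⟩ := Sym2.mem_iff_exists.1 hv
  obtain ⟨w', hw'⟩ := Sym2.mem_iff_exists.1 hv'
  apply hne
  have h1 : c s(v, w) = some ((c e).get (hs e)) := by rw [← hw]; simp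
  have h2 : c s(v, w') = some ((c e).get (hs e)) := by rw [heq, ← hw']; simp
  rw [Subtype.ext_iff, hw, hw', hc.proper h1 h2]

end Vizing

/-! ### Regular graphs without short cycles, as Cayley graphs. -/

section Girth

/-- Every walk joining the ends of an edge, but avoiding that edge, has length at least `N`. -/
def HasLongDetours {W : Type*} (G : SimpleGraph W) (N : ℕ) : Prop :=
  ∀ ⦃x y⦄, G.Adj x y → ∀ p : G.Walk x y, s(x, y) ∉ p.edges → N ≤ p.length

/-- Words over `Fin k` of length at most `N` without equal consecutive letters. -/
abbrev ReducedWord (k N : ℕ) : Type :=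
  {l : List (Fin k) // l.IsChain (· ≠ ·) ∧ l.length ≤ N}

instance (k N : ℕ) : Finite (ReducedWord k N) :=
  Set.Finite.to_subtype ((List.finite_length_le (Fin k) N).subset fun _ h => h.2)

variable {k N : ℕ}

/-- Cancel the first letter if it is `i`, and otherwise prepend `i`, as far as the bound on the
length permits. -/
def ReducedWord.act (i : Fin k) (l : ReducedWord k N) : ReducedWord k N :=
  if l.1.head? = some i then
    ⟨l.1.tail, l.2.1.tail, by have := l.2.2; simp only [List.length_tail]; omega⟩
  else if hl : l.1.head? ≠ some i ∧ l.1.length < N then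
    ⟨i :: l.1, List.isChain_cons.2 ⟨fun j hj h => hl.1 (by rw [h]; exact hj), l.2.1⟩,
      by simp only [List.length_cons]; omega⟩
  else l

lemma ReducedWord.act_involutive (i : Fin k) :
    Function.Involutive (ReducedWord.act (N := N) i) := by
  rintro ⟨l, hl, hN⟩
  by_cases h : l.head? = some i
  · obtain ⟨t, rfl⟩ : ∃ t, l = i :: t := by
      cases l with
      | nil => simp at h
      | cons j t =>
        simp only [List.head?_cons, Option.some.injEq] at h
        exact ⟨t, by rw [h]⟩
    have ht : t.head? ≠ some i := fun h' => (List.isChain_cons.1 hl).1 i h' rfl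
    have hlen : t.length < N := by simpa using hN
    simp [act, ht, hlen]
  · by_cases hlen : l.length < N
    · simp [act, h, hlen]
    · simp [act, h, hlen]

/-- The permutation of the reduced words defined by a letter. -/
def ReducedWord.perm (i : Fin k) : Equiv.Perm (ReducedWord k N) :=
  (ReducedWord.act_involutive i).toPerm

lemma ReducedWord.perm_mul_self (i : Fin k) : perm (N := N) i * perm i = 1 :=
  Equiv.ext fun l => act_involutive i l

/-- Applied to the empty word, the letters rebuild `l` from its end; no cancellation occurs since
`l` is reduced, and the length bound is never in the way. So short nonempty reduced words act
nontrivially. -/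
lemma ReducedWord.prod_perm_nil (l : List (Fin k)) (hl : l.IsChain (· ≠ ·)) (hN : l.length ≤ N) :
    (l.map (perm (N := N))).prod ⟨[], by simp⟩ = ⟨l, hl, hN⟩ := by
  induction l with
  | nil => simp
  | cons i l ih =>
    have hl' := List.isChain_cons.1 hl
    rw [List.map_cons, List.prod_cons, Equiv.Perm.mul_apply,
      ih hl'.2 (by simp only [List.length_cons] at hN; omega)]
    have h : l.head? ≠ some i := fun h' => hl'.1 i h' rfl
    have hlen : l.length < N := by simpa using hN
    change act i _ = _
    simp [act, h, hlen]

lemma ReducedWord.prod_perm_ne_one {l : List (Fin k)} (hl : l.IsChain (· ≠ ·))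
    (hN : l.length ≤ N) (h0 : l ≠ []) : (l.map (perm (N := N))).prod ≠ 1 := by
  intro h
  have h1 := prod_perm_nil l hl hN
  rw [h, Equiv.Perm.one_apply, Subtype.mk.injEq] at h1
  exact h0 h1.symm

/-- The Cayley graph of the group of permutations of the reduced words with respect to the
letters. -/
def letterGraph (k N : ℕ) : SimpleGraph (Equiv.Perm (ReducedWord k N)) where
  Adj g h := g ≠ h ∧ ∃ i, g = ReducedWord.perm i * h
  symm := ⟨by
    rintro g h ⟨hne, i, rfl⟩
    exact ⟨hne.symm, i, by rw [← mul_assoc, ReducedWord.perm_mul_self, one_mul]⟩⟩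
  loopless := ⟨fun _ h => h.1 rfl⟩

/-- The letters are involutions, so two equal consecutive letters would traverse the same edge back
and forth. The last clause records the first edge for the induction. -/
lemma exists_word_of_isTrail {g h : Equiv.Perm (ReducedWord k N)} (p : (letterGraph k N).Walk g h)
    (hp : p.IsTrail) : ∃ l : List (Fin k), l.IsChain (· ≠ ·) ∧ l.length = p.length ∧
      g = (l.map ReducedWord.perm).prod * h ∧
      ∀ i ∈ l.head?, s(g, ReducedWord.perm i * g) ∈ p.edges := by
  induction p with
  | nil => exact ⟨[], by simp⟩
  | @cons g g' h hadj p ih =>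
    rw [Walk.isTrail_cons] at hp
    obtain ⟨l, hl, hlen, hprod, hhead⟩ := ih hp.1
    obtain ⟨i, hi⟩ := hadj.2
    have hi' : ReducedWord.perm i * g = g' := by
      rw [hi, ← mul_assoc, ReducedWord.perm_mul_self, one_mul]
    refine ⟨i :: l, ?_, by simp [hlen], ?_, ?_⟩
    · refine List.isChain_cons.2 ⟨?_, hl⟩
      rintro j hj rfl
      apply hp.2
      rw [Sym2.eq_swap]
      convert hhead i hj using 2
    · rw [List.map_cons, List.prod_cons, mul_assoc, ← hprod, hi]
    · intro j hj
      simp only [List.head?_cons, Option.mem_def, Option.some.injEq] at hj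
      subst hj
      rw [hi', Walk.edges_cons]
      exact List.mem_cons_self

lemma hasLongDetours_letterGraph (k N : ℕ) : HasLongDetours (letterGraph k N) N := by
  classical
  intro x y hxy p hp
  by_contra hlt
  -- A detour shorter than `N`, made into a path and closed up by the edge, spells a nonempty
  -- reduced word of length at most `N` acting as the identity.
  have hpath : p.bypass.IsTrail := p.bypass_isPath.isTrail
  have hq : (Walk.cons hxy.symm p.bypass).IsTrail := by
    rw [Walk.isTrail_cons]
    refine ⟨hpath, fun h => hp ?_⟩
    rw [Sym2.eq_swap]
    exact p.edges_bypass_subset_edges h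
  obtain ⟨l, hl, hlen, hprod, -⟩ := exists_word_of_isTrail _ hq
  have hle := p.length_bypass_le_length
  rw [Walk.length_cons] at hlen
  refine ReducedWord.prod_perm_ne_one (N := N) hl (by omega) ?_ (mul_eq_right.1 hprod.symm)
  rintro rfl
  simp at hlen

lemma ReducedWord.perm_injective (hN : 1 ≤ N) :
    Function.Injective (ReducedWord.perm (k := k) (N := N)) := by
  intro i j hij
  have h1 := prod_perm_nil (N := N) [i] (by simp) (by simpa)
  have h2 := prod_perm_nil (N := N) [j] (by simp) (by simpa)
  simp only [List.map_cons, List.map_nil, List.prod_cons, List.prod_nil, mul_one] at h1 h2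
  rw [hij, h2] at h1
  simpa using h1.symm

lemma letterGraph_adj (hN : 1 ≤ N) {g h : Equiv.Perm (ReducedWord k N)} :
    (letterGraph k N).Adj g h ↔ ∃ i, ReducedWord.perm i * g = h := by
  constructor
  · rintro ⟨-, i, rfl⟩
    exact ⟨i, by rw [← mul_assoc, ReducedWord.perm_mul_self, one_mul]⟩
  · rintro ⟨i, rfl⟩
    refine ⟨fun h => ?_, i, by rw [← mul_assoc, ReducedWord.perm_mul_self, one_mul]⟩
    have := ReducedWord.prod_perm_ne_one (N := N) (l := [i]) (by simp) (by simpa) (by simp)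
    simp only [List.map_cons, List.map_nil, List.prod_cons, List.prod_nil, mul_one] at this
    exact this (mul_eq_right.1 h.symm)

end Girth

/-! ### Gluing copies at new vertices, and the parity obstruction. -/

section Glue

variable {X I Z : Type*}

/-- Take a copy of `G` for every index in `I`, delete the edge joining `pt true` to `pt false` in
each copy, and join the end `pt t` of the deleted edge of copy `i` to the new vertex `τ i t`. -/
def glue (G : SimpleGraph X) (pt : Bool → X) (τ : I → Bool → Z) : SimpleGraph (X × I ⊕ Z) where
  Adj
    | .inl (x, i), .inl (y, j) => i = j ∧ G.Adj x y ∧ s(x, y) ≠ s(pt true, pt false)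
    | .inl (x, i), .inr z => ∃ t, x = pt t ∧ τ i t = z
    | .inr z, .inl (x, i) => ∃ t, x = pt t ∧ τ i t = z
    | .inr _, .inr _ => False
  symm := ⟨by
    rintro (⟨x, i⟩ | z) (⟨y, j⟩ | z') h
    · exact ⟨h.1.symm, h.2.1.symm, by rw [Sym2.eq_swap]; exact h.2.2⟩
    · exact h
    · exact h
    · exact h⟩
  loopless := ⟨by
    rintro (⟨x, i⟩ | z) h
    · exact h.2.1.ne rfl
    · exact h⟩

variable {G : SimpleGraph X} {pt : Bool → X} {τ : I → Bool → Z}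

lemma glue_adj_inl_inl {x y : X} {i j : I} : (glue G pt τ).Adj (.inl (x, i)) (.inl (y, j)) ↔
    i = j ∧ G.Adj x y ∧ s(x, y) ≠ s(pt true, pt false) := Iff.rfl

lemma glue_adj_inl_inr {x : X} {i : I} {z : Z} :
    (glue G pt τ).Adj (.inl (x, i)) (.inr z) ↔ ∃ t, x = pt t ∧ τ i t = z := Iff.rfl

lemma glue_adj_inr_inl {x : X} {i : I} {z : Z} :
    (glue G pt τ).Adj (.inr z) (.inl (x, i)) ↔ ∃ t, x = pt t ∧ τ i t = z := Iff.rfl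

lemma not_glue_adj_inr_inr {z z' : Z} : ¬ (glue G pt τ).Adj (.inr z) (.inr z') := fun h => h

/-- The walk is followed inside copy `i` until it first steps to a new vertex, which is only
possible from an end of the deleted edge. -/
lemma exists_walk_to_pt {v w : X × I ⊕ Z} (p : (glue G pt τ).Walk v w) :
    ∀ {x i z}, v = .inl (x, i) → w = .inr z →
      ∃ t, ∃ q : G.Walk x (pt t), s(pt true, pt false) ∉ q.edges ∧ q.length < p.length ∧
        s(.inl (pt t, i), .inr (τ i t)) ∈ p.edges ∧
        ∀ u u', s(u, u') ∈ q.edges → s(.inl (u, i), .inl (u', i)) ∈ p.edges := by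
  induction p with
  | nil =>
    rintro x i z rfl h
    cases h
  | @cons v v' w hadj p ih =>
    rintro x i z rfl rfl
    rcases v' with ⟨x', i'⟩ | z'
    · rw [glue_adj_inl_inl] at hadj
      obtain ⟨rfl, hxx', hne⟩ := hadj
      obtain ⟨t, q, h1, h2, h3, h4⟩ := ih rfl rfl
      refine ⟨t, .cons hxx' q, ?_, by simpa using h2, ?_, ?_⟩
      · rw [Walk.edges_cons, List.mem_cons, not_or]
        exact ⟨hne.symm, h1⟩
      · rw [Walk.edges_cons]
        exact List.mem_cons_of_mem _ h3
      · intro u u' hu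
        rw [Walk.edges_cons, List.mem_cons] at hu ⊢
        rcases hu with hu | hu
        · left
          rcases Sym2.eq_iff.1 hu with ⟨rfl, rfl⟩ | ⟨rfl, rfl⟩
          · rfl
          · exact Sym2.eq_swap
        · exact Or.inr (h4 u u' hu)
    · rw [glue_adj_inl_inr] at hadj
      obtain ⟨t, rfl, rfl⟩ := hadj
      exact ⟨t, .nil, by simp, by simp, by simp, by simp⟩

lemma exists_walk_or_mem_support {v w : X × I ⊕ Z} (p : (glue G pt τ).Walk v w) :
    ∀ {x i y j}, v = .inl (x, i) → w = .inl (y, j) →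
      (∃ q : G.Walk x y, q.length ≤ p.length ∧
        ∀ u u', s(u, u') ∈ q.edges → s(.inl (u, i), .inl (u', i)) ∈ p.edges) ∨
      ∃ z, .inr z ∈ p.support := by
  induction p with
  | nil =>
    rintro x i y j rfl h
    cases h
    exact Or.inl ⟨.nil, by simp⟩
  | @cons v v' w hadj p ih =>
    rintro x i y j rfl rfl
    rcases v' with ⟨x', i'⟩ | z'
    · rw [glue_adj_inl_inl] at hadj
      obtain ⟨rfl, hxx', hne⟩ := hadj
      rcases ih rfl rfl with ⟨q, h1, h2⟩ | ⟨z, hz⟩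
      · refine Or.inl ⟨.cons hxx' q, by simpa using h1, ?_⟩
        intro u u' hu
        rw [Walk.edges_cons, List.mem_cons] at hu ⊢
        rcases hu with hu | hu
        · left
          rcases Sym2.eq_iff.1 hu with ⟨rfl, rfl⟩ | ⟨rfl, rfl⟩
          · rfl
          · exact Sym2.eq_swap
        · exact Or.inr (h2 u u' hu)
      · exact Or.inr ⟨z, by rw [Walk.support_cons]; exact List.mem_cons_of_mem _ hz⟩
    · exact Or.inr ⟨z', by simp⟩

lemma mk_pt_eq {t t' : Bool} (h : t ≠ t') : s(pt t, pt t') = s(pt true, pt false) := by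
  cases t <;> cases t' <;> simp_all

lemma adj_pt (hpt : G.Adj (pt true) (pt false)) {t t' : Bool} (h : t ≠ t') :
    G.Adj (pt t) (pt t') := by
  rw [← mem_edgeSet, mk_pt_eq h]
  exact hpt

/-- A detour in the glued graph projects to one in `G`. If it leaves the copy, its initial and final
segments reach ends of the deleted edge; they are joined directly when these ends agree, and
otherwise through the deleted edge, which is no longer than the excursion. -/
lemma HasLongDetours.glue {N : ℕ} (hG : HasLongDetours G N) (hpt : G.Adj (pt true) (pt false)) :
    HasLongDetours (glue G pt τ) N := by
  classical
  have aux : ∀ {x i z} (p : (DegreeAntiRamsey.glue G pt τ).Walk (.inl (x, i)) (.inr z)),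
      (DegreeAntiRamsey.glue G pt τ).Adj (.inl (x, i)) (.inr z) →
      s(.inl (x, i), .inr z) ∉ p.edges → N ≤ p.length := by
    intro x i z p hadj hp
    obtain ⟨t, rfl, rfl⟩ := glue_adj_inl_inr.1 hadj
    obtain ⟨t', q, h1, h2, h3, -⟩ := exists_walk_to_pt p rfl rfl
    have htt : t ≠ t' := by
      rintro rfl
      exact hp h3
    exact (hG (adj_pt hpt htt) q (by rwa [mk_pt_eq htt])).trans h2.le
  rintro (⟨x, i⟩ | z) (⟨y, j⟩ | z') hadj p hp
  · obtain ⟨rfl, hxy, hne⟩ := glue_adj_inl_inl.1 hadj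
    rcases exists_walk_or_mem_support p rfl rfl with ⟨q, h1, h2⟩ | ⟨z, hz⟩
    · exact (hG hxy q fun h => hp (h2 _ _ h)).trans h1
    · obtain ⟨t, q, h1, h2, -, h4⟩ := exists_walk_to_pt (p.takeUntil _ hz) rfl rfl
      obtain ⟨t', q', h1', h2', -, h4'⟩ := exists_walk_to_pt (p.dropUntil _ hz).reverse rfl rfl
      have hlen : (p.takeUntil _ hz).length + (p.dropUntil _ hz).length = p.length := by
        rw [← Walk.length_append, Walk.take_spec]
      rw [Walk.length_reverse] at h2'
      have hq : s(x, y) ∉ q.edges := fun h =>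
        hp (p.edges_takeUntil_subset_edges hz (h4 _ _ h))
      have hq' : s(x, y) ∉ q'.edges := fun h => by
        have := h4' _ _ h
        rw [Walk.edges_reverse, List.mem_reverse] at this
        exact hp (p.edges_dropUntil_subset_edges hz this)
      by_cases htt : t = t'
      · subst htt
        have := hG hxy (q.append q'.reverse) (by
          rw [Walk.edges_append, List.mem_append, Walk.edges_reverse, List.mem_reverse, not_or]
          exact ⟨hq, hq'⟩)
        rw [Walk.length_append, Walk.length_reverse] at this
        omega
      · have := hG hxy (q.append (.cons (adj_pt hpt htt) q'.reverse)) (by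
          rw [Walk.edges_append, List.mem_append, Walk.edges_cons, List.mem_cons,
            Walk.edges_reverse, List.mem_reverse, not_or, not_or, mk_pt_eq htt]
          exact ⟨hq, hne, hq'⟩)
        rw [Walk.length_append, Walk.length_cons, Walk.length_reverse] at this
        omega
  · exact aux p hadj hp
  · rw [← Walk.length_reverse]
    refine aux p.reverse hadj.symm ?_
    rw [Walk.edges_reverse, List.mem_reverse, Sym2.eq_swap]
    exact hp
  · exact absurd hadj not_glue_adj_inr_inr

/-- Edges of `G` sharing a vertex get distinct values under `c`. -/
def IsProperOn {W K : Type*} (G : SimpleGraph W) (c : Sym2 W → K) : Prop :=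
  ∀ ⦃x y z⦄, G.Adj x y → G.Adj x z → c s(x, y) = c s(x, z) → y = z

/-- Some edge at `x` has the value `k`. -/
def ColourAt {W K : Type*} (G : SimpleGraph W) (c : Sym2 W → K) (x : W) (k : K) : Prop :=
  ∃ y, G.Adj x y ∧ c s(x, y) = k

lemma even_card_of_perfect_matching [DecidableEq X] (s : Finset X) (r : X → X → Prop)
    (hsymm : ∀ {x y}, r x y → r y x) (huniq : ∀ {x y z}, r x y → r x z → y = z)
    (hex : ∀ x ∈ s, ∃ y ∈ s, y ≠ x ∧ r x y) : Even s.card := by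
  choose! g hg hne hr using hex
  have h : ∑ x ∈ s, (1 : ZMod 2) = 0 :=
    Finset.sum_involution (fun x _ => g x) (fun _ _ => by decide) (fun x hx _ => hne x hx) hg
      (fun x hx => huniq (hr _ (hg x hx)) (hsymm (hr x hx)))
  rw [Finset.sum_const, nsmul_eq_mul, mul_one, ZMod.natCast_eq_zero_iff] at h
  exact even_iff_two_dvd.2 h

/-- If both ends of the deleted edge of some copy are joined to the same new vertex, then no
proper edge colouring shows the same colours at all vertices. -/
lemma exists_colourAt_ne_of_glue [Finite X] {K : Type*} (m : X → X) (hm : ∀ x, m (m x) = x)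
    (hmG : ∀ x, G.Adj x (m x)) (hpt : m (pt true) = pt false) {i : I}
    (hτ : τ i true = τ i false) {c : Sym2 (X × I ⊕ Z) → K} (hc : IsProperOn (glue G pt τ) c) :
    ∃ x y k, (glue G pt τ).Adj x y ∧ ColourAt (glue G pt τ) c y k ∧
      ¬ ColourAt (glue G pt τ) c x k := by
  classical
  have := Fintype.ofFinite X
  by_contra! hcon
  have hsame : ∀ {x y k}, (glue G pt τ).Adj x y →
      (ColourAt (glue G pt τ) c x k ↔ ColourAt (glue G pt τ) c y k) :=
    fun hxy => ⟨hcon _ _ _ hxy.symm, hcon _ _ _ hxy⟩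
  set z := τ i true with hz
  set C : Finset X := {x | ∀ k, ColourAt (glue G pt τ) c (.inl (x, i)) k ↔
    ColourAt (glue G pt τ) c (.inr z) k} with hC
  have hmemC : ∀ {x}, x ∈ C ↔ ∀ k, ColourAt (glue G pt τ) c (.inl (x, i)) k ↔
    ColourAt (glue G pt τ) c (.inr z) k := by simp [hC]
  have hτz : ∀ t, τ i t = z := by
    rintro (_ | _)
    · exact hτ.symm
    · rfl
  have hadj_pt : ∀ t, (glue G pt τ).Adj (.inl (pt t, i)) (.inr z) := fun t => ⟨t, rfl, hτz t⟩
  have hptC : ∀ t, pt t ∈ C := fun t => hmemC.2 fun k => hsame (hadj_pt t)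
  have hpt_ne : pt true ≠ pt false := by
    rw [← hpt]
    exact (hmG _).ne
  have hpt' : m (pt false) = pt true := by rw [← hpt, hm]
  have hstep : ∀ {x y}, (glue G pt τ).Adj (.inl (x, i)) (.inl (y, i)) → x ∈ C → y ∈ C :=
    fun hxy hx => hmemC.2 fun k => (hsame hxy).symm.trans (hmemC.1 hx k)
  -- The matching `m` preserves `C`: adjacent vertices see the same colours, and both ends of the
  -- deleted edge lie in `C`.
  have heven : Even C.card := by
    refine even_card_of_perfect_matching C (fun x y => m x = y) ?_ ?_ ?_
    · rintro x y rfl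
      exact hm x
    · rintro x y z rfl h
      exact h
    · intro x hx
      refine ⟨m x, ?_, (hmG x).ne.symm, rfl⟩
      by_cases h : s(x, m x) = s(pt true, pt false)
      · rcases Sym2.eq_iff.1 h with ⟨-, h⟩ | ⟨-, h⟩ <;> rw [h] <;> exact hptC _
      · exact hstep ⟨rfl, hmG x, h⟩ hx
  -- The colour of the edge from `pt true` to `z` occurs at every vertex of `C`. Its edges match up
  -- `C` without `pt true`: at `pt false` the edge to `z` has another colour. The two parities
  -- contradict each other.
  have heven' : Even (C.erase (pt true)).card := by
    refine even_card_of_perfect_matching _ (fun x y =>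
      (glue G pt τ).Adj (.inl (x, i)) (.inl (y, i)) ∧
        c s(.inl (x, i), .inl (y, i)) = c s(.inl (pt true, i), .inr z)) ?_ ?_ ?_
    · rintro x y ⟨h, h'⟩
      exact ⟨h.symm, by rw [Sym2.eq_swap]; exact h'⟩
    · rintro x y w ⟨h1, h1'⟩ ⟨h2, h2'⟩
      have := hc h1 h2 (h1'.trans h2'.symm)
      simpa using this
    · intro x hx
      obtain ⟨hxa, hxC⟩ := Finset.mem_erase.1 hx
      obtain ⟨w, hw, hcw⟩ := (hmemC.1 hxC _).2 ⟨.inl (pt true, i), (hadj_pt true).symm, rfl⟩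
      rw [Sym2.eq_swap (a := Sum.inr z)] at hcw
      rcases w with ⟨y, j⟩ | z'
      · obtain rfl := (glue_adj_inl_inl.1 hw).1
        refine ⟨y, Finset.mem_erase.2 ⟨?_, hstep hw hxC⟩, ?_, hw, hcw⟩
        · rintro rfl
          rw [Sym2.eq_swap] at hcw
          exact absurd (hc hw.symm (hadj_pt true) hcw) (by simp)
        · rintro rfl
          exact hw.ne rfl
      · obtain ⟨t, rfl, rfl⟩ := glue_adj_inl_inr.1 hw
        cases t with
        | true => exact absurd rfl hxa
        | false =>
          rw [hτz, Sym2.eq_swap, Sym2.eq_swap (a := Sum.inl (pt true, i))] at hcw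
          have := hc (hadj_pt false).symm (hadj_pt true).symm hcw
          simp only [Sum.inl.injEq, Prod.mk.injEq, and_true] at this
          exact absurd this.symm hpt_ne
  have hcard := Finset.card_erase_add_one (hptC true)
  rw [← hcard, Nat.even_add_one] at heven
  exact heven heven'

end Glue

/-! ### The regular graph with unequal colour sets. -/

section RegularGraph

/-- There are regular graphs of degree `k ≥ 2` without short cycles such that in every proper edge
colouring two adjacent vertices see different colours. -/
lemma exists_regular_hasLongDetours {k : ℕ} (hk : 2 ≤ k) (N : ℕ) :
    ∃ (W : Type) (_ : Fintype W) (G : SimpleGraph W) (nb : W → Fin k → W),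
      (∀ v w, G.Adj v w ↔ ∃ j, nb v j = w) ∧ (∀ v, Function.Injective (nb v)) ∧
      HasLongDetours G N ∧ ∀ {K : Type} {c : Sym2 W → K}, IsProperOn G c →
        ∃ x y k, G.Adj x y ∧ ColourAt G c y k ∧ ¬ ColourAt G c x k := by
  classical
  obtain ⟨k, rfl⟩ := Nat.exists_eq_add_of_le' hk
  -- Words of length one must be allowed, so that distinct letters act as distinct nontrivial
  -- permutations even for `N = 0`.
  set N' := N + 1 with hN'
  have hN1 : 1 ≤ N' := by omega
  have := Fintype.ofFinite (ReducedWord (k + 2) N')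
  set X := Equiv.Perm (ReducedWord (k + 2) N') with hX
  set G₀ : SimpleGraph X := letterGraph (k + 2) N' with hG₀
  set π : Fin (k + 2) → X := ReducedWord.perm with hπ
  have hππ : ∀ j (x : X), π j * (π j * x) = x := fun j x => by
    rw [← mul_assoc, hπ, ReducedWord.perm_mul_self, one_mul]
  have hadj₀ : ∀ {x y : X}, G₀.Adj x y ↔ ∃ j, π j * x = y := letterGraph_adj hN1
  have hπinj : Function.Injective π := ReducedWord.perm_injective hN1
  set pt : Bool → X := fun t => if t then 1 else π 0 with hptdef
  have hpt1 : pt true = 1 := rfl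
  have hpt0 : pt false = π 0 := rfl
  have hpt_adj : G₀.Adj (pt true) (pt false) := hadj₀.2 ⟨0, by rw [hpt1, hpt0, mul_one]⟩
  have hpt_inj : Function.Injective pt := by
    intro t t' h
    have h' := hpt_adj.ne
    cases t <;> cases t' <;> simp_all
  -- Loose end `t` of a copy would go to the new vertex `t`; exchanging two of these assignments
  -- sends both ends of copy `0` to `true` and both ends of copy `1` to `false`, and keeps the new
  -- vertices of full degree.
  set e : Fin (k + 2) × Bool ≃ Fin (k + 2) × Bool :=
    Equiv.swap ((0 : Fin (k + 2)), false) ((1 : Fin (k + 2)), true) with he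
  have hee : ∀ h, e (e h) = h := fun h => Equiv.swap_apply_self _ _ h
  set τ : Fin (k + 2) → Bool → Bool := fun i t => (e (i, t)).2 with hτ
  have hτ0 : τ 0 true = τ 0 false := by
    have h1 : e (0, true) = (0, true) := Equiv.swap_apply_of_ne_of_ne (by simp) (by simp)
    have h2 : e (0, false) = (1, true) := Equiv.swap_apply_left _ _
    simp [hτ, h1, h2]
  refine ⟨X × Fin (k + 2) ⊕ Bool, inferInstance, glue G₀ pt τ,
    Sum.elim (fun p j => if j = 0 ∧ p.1 = pt true then .inr (τ p.2 true)
      else if j = 0 ∧ p.1 = pt false then .inr (τ p.2 false) else .inl (π j * p.1, p.2))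
      (fun z j => .inl (pt (e (j, z)).2, (e (j, z)).1)), ?_, ?_, ?_, ?_⟩
  · rintro (⟨x, i⟩ | z) w
    · simp only [Sum.elim_inl]
      constructor
      · intro hadj
        rcases w with ⟨y, i'⟩ | z
        · obtain ⟨rfl, hxy, hne⟩ := glue_adj_inl_inl.1 hadj
          obtain ⟨j, rfl⟩ := hadj₀.1 hxy
          refine ⟨j, ?_⟩
          rw [if_neg, if_neg]
          · rintro ⟨rfl, rfl⟩
            apply hne
            have h := hππ 0 1
            rw [mul_one] at h
            rw [hpt0, hpt1, h, Sym2.eq_swap]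
          · rintro ⟨rfl, rfl⟩
            apply hne
            rw [hpt0, hpt1, mul_one]
        · obtain ⟨t, rfl, rfl⟩ := glue_adj_inl_inr.1 hadj
          refine ⟨0, ?_⟩
          cases t
          · rw [if_neg, if_pos ⟨rfl, rfl⟩]
            rintro ⟨-, h⟩
            exact absurd (hpt_inj h) (by simp)
          · rw [if_pos ⟨rfl, rfl⟩]
      · rintro ⟨j, rfl⟩
        split_ifs with h1 h2
        · exact ⟨true, h1.2, rfl⟩
        · exact ⟨false, h2.2, rfl⟩
        · refine ⟨rfl, hadj₀.2 ⟨j, rfl⟩, fun h => ?_⟩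
          rcases Sym2.eq_iff.1 h with ⟨hx, h⟩ | ⟨hx, h⟩
          · refine h1 ⟨hπinj ?_, hx⟩
            rw [hx, hpt0, hpt1, mul_one] at h
            exact h
          · refine h2 ⟨hπinj ?_, hx⟩
            rw [hx, hpt0, hpt1] at h
            have h' := hππ j (π 0)
            rw [h, mul_one] at h'
            exact h'
    · simp only [Sum.elim_inr]
      constructor
      · intro hadj
        rcases w with ⟨x, i⟩ | z'
        · obtain ⟨t, rfl, rfl⟩ := glue_adj_inr_inl.1 hadj
          refine ⟨(e (i, t)).1, ?_⟩
          have : e ((e (i, t)).1, τ i t) = (i, t) := hee (i, t)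
          rw [this]
        · exact absurd hadj not_glue_adj_inr_inr
      · rintro ⟨j, rfl⟩
        refine ⟨_, rfl, ?_⟩
        have : e ((e (j, z)).1, (e (j, z)).2) = (j, z) := hee (j, z)
        simp only [hτ, this]
  · rintro (⟨x, i⟩ | z) j j' hjj
    · simp only [Sum.elim_inl] at hjj
      split_ifs at hjj with h1 h2 h3 h4 h5 h6 h7 <;>
        simp_all only [reduceCtorEq, Sum.inl.injEq, Prod.mk.injEq, and_true]
      exact hπinj (mul_right_cancel hjj)
    · simp only [Sum.elim_inr, Sum.inl.injEq, Prod.mk.injEq] at hjj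
      have h := e.injective (Prod.ext hjj.2 (hpt_inj hjj.1))
      exact (Prod.mk.inj h).1
  · intro x y hxy p hp
    have h : HasLongDetours G₀ N' := hasLongDetours_letterGraph _ _
    have := h.glue (τ := τ) hpt_adj hxy p hp
    omega
  · intro K c hc
    exact exists_colourAt_ne_of_glue (fun x => π 0 * x) (hππ 0) (fun x => hadj₀.2 ⟨0, rfl⟩)
      (by rw [hpt1, hpt0, mul_one]) hτ0 hc

end RegularGraph

/-! ### Hosts: disjoint copies, one for each label. -/

section Host

/-- The properties of a graph `G` and of a labelling `κ` of its components under which rainbow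
forests can be found in all proper edge colourings: `G` is regular of degree `k`, with the
neighbours of each vertex enumerated by `nb`, it has no short cycles, all labels occur, and
wherever a label occurs every proper edge colouring shows different colours at the ends of some
edge. -/
structure IsHost {W I : Type} (G : SimpleGraph W) (κ : W → I) (k N : ℕ) (nb : W → Fin k → W) :
    Prop where
  adj_iff : ∀ {v w}, G.Adj v w ↔ ∃ j, nb v j = w
  nb_injective : ∀ v, Function.Injective (nb v)
  hasLongDetours : HasLongDetours G N
  label_eq : ∀ {v w}, G.Adj v w → κ v = κ w
  exists_label : ∀ i, ∃ v, κ v = i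
  exists_colourAt_ne : ∀ (i : I) {K : Type} {c : Sym2 W → K}, IsProperOn G c →
    ∃ x y α, κ x = i ∧ G.Adj x y ∧ ColourAt G c y α ∧ ¬ ColourAt G c x α

lemma exists_walk_of_boxProd_bot {W I : Type*} {G : SimpleGraph W} {v w : W × I}
    (p : (G □ (⊥ : SimpleGraph I)).Walk v w) :
    ∃ q : G.Walk v.1 w.1, q.length = p.length ∧
      ∀ u u', s(u, u') ∈ q.edges → s((u, v.2), (u', v.2)) ∈ p.edges := by
  induction p with
  | nil => exact ⟨.nil, by simp⟩
  | @cons v v' w hadj p ih =>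
    obtain ⟨x, i⟩ := v
    obtain ⟨x', i'⟩ := v'
    obtain ⟨q, h1, h2⟩ := ih
    simp only [boxProd_adj, bot_adj, false_and, or_false] at hadj
    obtain ⟨hxx, rfl⟩ := hadj
    refine ⟨.cons hxx q, by simp [h1], ?_⟩
    intro u u' hu
    rw [Walk.edges_cons, List.mem_cons] at hu ⊢
    rcases hu with hu | hu
    · left
      rcases Sym2.eq_iff.1 hu with ⟨rfl, rfl⟩ | ⟨rfl, rfl⟩
      · rfl
      · exact Sym2.eq_swap
    · exact Or.inr (h2 u u' hu)

lemma exists_isHost (I : Type) [Finite I] {k : ℕ} (hk : 2 ≤ k) (N : ℕ) :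
    ∃ (W : Type) (_ : Fintype W) (G : SimpleGraph W) (κ : W → I) (nb : W → Fin k → W),
      IsHost G κ k N nb := by
  have := Fintype.ofFinite I
  obtain ⟨W, _, G, nb, hadj, hinj, hlong, hclass⟩ := exists_regular_hasLongDetours hk N
  have hc' : ∀ {K : Type} {c : Sym2 (W × I) → K} (i : I),
      IsProperOn (G □ (⊥ : SimpleGraph I)) c → IsProperOn G fun e => c (e.map fun x => (x, i)) := by
    intro K c i hc x y z hxy hxz h
    have := hc (x := (x, i)) (y := (y, i)) (z := (z, i)) (by simpa) (by simpa) h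
    simpa using this
  refine ⟨W × I, inferInstance, G □ ⊥, Prod.snd, fun v j => (nb v.1 j, v.2), ?_, ?_, ?_, ?_, ?_, ?_⟩
  · rintro ⟨x, i⟩ ⟨y, j⟩
    simp [hadj]
  · rintro ⟨x, i⟩ j j' h
    simp only [Prod.mk.injEq, and_true] at h
    exact hinj x h
  · rintro ⟨x, i⟩ ⟨y, j⟩ hxy p hp
    simp only [boxProd_adj, bot_adj, false_and, or_false] at hxy
    obtain ⟨hxy, rfl⟩ := hxy
    obtain ⟨q, h1, h2⟩ := exists_walk_of_boxProd_bot p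
    rw [← h1]
    exact hlong hxy q fun h => hp (h2 _ _ h)
  · rintro ⟨x, i⟩ ⟨y, j⟩ hxy
    simp only [boxProd_adj, bot_adj, false_and, or_false] at hxy
    exact hxy.2
  · intro i
    -- The colouring giving every edge its own colour serves only to produce a vertex.
    obtain ⟨x, -⟩ := hclass (K := Sym2 W) (c := id) fun x y z _ _ h => Sym2.congr_right.1 h
    exact ⟨(x, i), rfl⟩
  · intro i K c hc
    obtain ⟨x, y, α, hxy, ⟨z, hyz, hz⟩, hx⟩ := hclass (hc' i hc)
    refine ⟨(x, i), (y, i), α, rfl, by simpa, ⟨(z, i), by simpa, hz⟩, ?_⟩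
    rintro ⟨⟨w, j⟩, hw, hcw⟩
    simp only [boxProd_adj, bot_adj, false_and, or_false] at hw
    obtain ⟨hw, rfl⟩ := hw
    exact hx ⟨w, hw, hcw⟩

variable {W I : Type} {G : SimpleGraph W} {κ : W → I} {k N : ℕ} {nb : W → Fin k → W}
  {K : Type} {c : Sym2 W → K}

lemma IsHost.colour_nb_injective (hG : IsHost G κ k N nb) (hc : IsProperOn G c) (v : W) :
    Function.Injective fun j => c s(v, nb v j) := fun _ _ h =>
  hG.nb_injective v (hc (hG.adj_iff.2 ⟨_, rfl⟩) (hG.adj_iff.2 ⟨_, rfl⟩) h)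

/-- The edges at `v` show exactly `k` colours. If all lay in `A`, then `A` would have at least `k`
elements, and with `k` elements it could contain no further colour. -/
lemma IsHost.exists_adj_notMem [DecidableEq K] (hG : IsHost G κ k N nb) (hc : IsProperOn G c)
    (v : W) (A : Finset K) (hA : A.card < k ∨ A.card ≤ k ∧ ∃ α ∈ A, ¬ ColourAt G c v α) :
    ∃ w, G.Adj v w ∧ c s(v, w) ∉ A := by
  by_contra! hcon
  set T : Finset K := Finset.univ.image fun j => c s(v, nb v j) with hT
  have hcard : T.card = k := by
    rw [hT, Finset.card_image_of_injective _ (hG.colour_nb_injective hc v), Finset.card_univ,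
      Fintype.card_fin]
  have hsub : T ⊆ A := by
    intro α hα
    obtain ⟨j, -, rfl⟩ := Finset.mem_image.1 hα
    exact hcon _ (hG.adj_iff.2 ⟨j, rfl⟩)
  rcases hA with hA | ⟨hA, α, hα, hαv⟩
  · have := Finset.card_le_card hsub
    omega
  · have hTA : T = A := Finset.eq_of_subset_of_card_le hsub (by omega)
    rw [← hTA] at hα
    obtain ⟨j, -, rfl⟩ := Finset.mem_image.1 hα
    exact hαv ⟨_, hG.adj_iff.2 ⟨j, rfl⟩, rfl⟩

/-- Wherever a label occurs there is an edge whose colour does not occur at a given vertex. -/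
lemma IsHost.exists_adj_not_colourAt (hG : IsHost G κ k N nb) (hc : IsProperOn G c) (x : W)
    (i : I) : ∃ y z, κ y = i ∧ G.Adj y z ∧ ¬ ColourAt G c x (c s(y, z)) := by
  classical
  obtain ⟨u, y, α, hu, huy, ⟨z, hyz, rfl⟩, huα⟩ := hG.exists_colourAt_ne i hc
  by_contra! hcon
  set T : W → Finset K := fun v => Finset.univ.image fun j => c s(v, nb v j) with hT
  have hcard : ∀ v, (T v).card = k := fun v => by
    rw [hT, Finset.card_image_of_injective _ (hG.colour_nb_injective hc v), Finset.card_univ,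
      Fintype.card_fin]
  have hmem : ∀ {v α}, α ∈ T v ↔ ColourAt G c v α := by
    intro v α
    simp only [hT, Finset.mem_image, Finset.mem_univ, true_and]
    constructor
    · rintro ⟨j, rfl⟩
      exact ⟨_, hG.adj_iff.2 ⟨j, rfl⟩, rfl⟩
    · rintro ⟨w, hw, rfl⟩
      obtain ⟨j, rfl⟩ := hG.adj_iff.1 hw
      exact ⟨j, rfl⟩
  -- The colours at `u` together with the colour of `yz`, absent at `u`, would be `k + 1` colours at
  -- `x`.
  have hsub : insert (c s(y, z)) (T u) ⊆ T x := by
    intro α hα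
    rw [hmem]
    rcases Finset.mem_insert.1 hα with rfl | hα
    · exact hcon y z ((hG.label_eq huy).symm.trans hu) hyz
    · obtain ⟨w, hw, rfl⟩ := hmem.1 hα
      exact hcon u w hu hw
  have h1 := Finset.card_le_card hsub
  rw [Finset.card_insert_of_notMem (fun h => huα (hmem.1 h)), hcard, hcard] at h1
  omega

end Host

/-! ### Growing a vertex set through a forest. -/

section Growing

variable {V : Type*} {H : SimpleGraph V} {S : Set V}

/-- The edges of `H` with both ends in `S`. -/
def edgesWithin (H : SimpleGraph V) (S : Set V) : SimpleGraph V where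
  Adj a b := H.Adj a b ∧ a ∈ S ∧ b ∈ S
  symm := ⟨fun _ _ h => ⟨h.1.symm, h.2.2, h.2.1⟩⟩
  loopless := ⟨fun _ h => h.1.ne rfl⟩

lemma edgesWithin_mono {S T : Set V} (h : S ⊆ T) : edgesWithin H S ≤ edgesWithin H T :=
  fun _ _ hab => ⟨hab.1, h hab.2.1, h hab.2.2⟩

/-- The intersection of `S` with any component of `H` is connected. -/
def IsConnectedWithin (H : SimpleGraph V) (S : Set V) : Prop :=
  ∀ ⦃a⦄, a ∈ S → ∀ ⦃b⦄, b ∈ S → H.Reachable a b → (edgesWithin H S).Reachable a b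

/-- A second neighbour of `y` in `S` would close a cycle through `py`, which is a bridge. Thus each
added vertex contributes at most one edge to the embedded part. -/
lemma IsConnectedWithin.eq_of_adj (hS : IsConnectedWithin H S) (hH : H.IsAcyclic) {p q y : V}
    (hp : p ∈ S) (hq : q ∈ S) (hy : y ∉ S) (hpy : H.Adj p y) (hqy : H.Adj q y) : q = p := by
  by_contra hne
  have hbridge := isAcyclic_iff_forall_adj_isBridge.1 hH hpy
  rw [isBridge_iff] at hbridge
  apply hbridge
  have h1 : (H.deleteEdges {s(p, y)}).Reachable p q := by
    refine (hS hp hq (hpy.reachable.trans hqy.symm.reachable)).mono ?_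
    intro a b hab
    rw [deleteEdges_adj]
    refine ⟨hab.1, ?_⟩
    rw [Set.mem_singleton_iff, Sym2.eq_iff]
    rintro (⟨-, rfl⟩ | ⟨rfl, -⟩)
    · exact hy hab.2.2
    · exact hy hab.2.1
  refine h1.trans (Adj.reachable ?_)
  rw [deleteEdges_adj]
  refine ⟨hqy, ?_⟩
  rw [Set.mem_singleton_iff, Sym2.congr_left]
  exact hne

lemma IsConnectedWithin.insert_of_adj (hS : IsConnectedWithin H S) {p y : V} (hp : p ∈ S)
    (hpy : H.Adj p y) : IsConnectedWithin H (insert y S) := by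
  have hmono : edgesWithin H S ≤ edgesWithin H (insert y S) :=
    edgesWithin_mono (Set.subset_insert y S)
  have hpy' : (edgesWithin H (insert y S)).Adj p y := ⟨hpy, Or.inr hp, Or.inl rfl⟩
  have hy : ∀ b ∈ S, H.Reachable y b → (edgesWithin H (insert y S)).Reachable y b :=
    fun b hb hyb => hpy'.symm.reachable.trans ((hS hp hb (hpy.reachable.trans hyb)).mono hmono)
  rintro a (rfl | ha) b (rfl | hb) hab
  · exact .refl _
  · exact hy b hb hab
  · exact (hy a ha hab.symm).symm
  · exact (hS ha hb hab).mono hmono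

lemma IsConnectedWithin.insert_of_not_reachable (hS : IsConnectedWithin H S) {y : V}
    (hy : ∀ a ∈ S, ¬ H.Reachable a y) : IsConnectedWithin H (insert y S) := by
  rintro a (rfl | ha) b (rfl | hb) hab
  · exact .refl _
  · exact absurd hab.symm (hy b hb)
  · exact absurd hab (hy a ha)
  · exact (hS ha hb hab).mono (edgesWithin_mono (Set.subset_insert y S))

lemma exists_adj_or_not_reachable (H : SimpleGraph V) (hS : S ≠ Set.univ) :
    ∃ y ∉ S, (∃ p ∈ S, H.Adj p y) ∨ ∀ a ∈ S, ¬ H.Reachable a y := by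
  obtain ⟨z, hz⟩ := (Set.ne_univ_iff_exists_notMem S).1 hS
  by_cases h : ∀ a ∈ S, ¬ H.Reachable a z
  · exact ⟨z, hz, Or.inr h⟩
  · push Not at h
    obtain ⟨a, ha, ⟨p⟩⟩ := h
    obtain ⟨d, -, hd1, hd2⟩ := p.exists_boundary_dart S ha hz
    exact ⟨d.snd, hd2, Or.inl ⟨d.fst, hd1, d.adj⟩⟩

end Growing

/-! ### Rainbow embeddings of forests into hosts. -/

section Embedding

variable {V : Type*} {W I K : Type}

/-- The part of `H` inside `S` is mapped by `f` to edges of `G` with distinct colours, and `f`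
takes the labels `ι` to the labels `κ`. -/
structure IsRainbowOn (G : SimpleGraph W) (κ : W → I) (c : Sym2 W → K) (H : SimpleGraph V)
    (ι : V → I) (S : Set V) (f : V → W) : Prop where
  adj : ∀ {a b}, a ∈ S → b ∈ S → H.Adj a b → G.Adj (f a) (f b)
  rainbow : ∀ {a b a' b'}, a ∈ S → b ∈ S → a' ∈ S → b' ∈ S → H.Adj a b → H.Adj a' b' →
    c s(f a, f b) = c s(f a', f b') → s(a, b) = s(a', b')
  label : ∀ {a}, a ∈ S → κ (f a) = ι a

variable {G : SimpleGraph W} {κ : W → I} {c : Sym2 W → K} {H : SimpleGraph V} {ι : V → I}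
  {S : Set V} {f : V → W} {k N : ℕ} {nb : W → Fin k → W}

lemma IsRainbowOn.insert_of_adj [DecidableEq V] (hf : IsRainbowOn G κ c H ι S f) {p y : V} {q : W}
    (hp : p ∈ S) (hy : y ∉ S) (hpy : H.Adj p y) (huniq : ∀ p' ∈ S, H.Adj p' y → p' = p)
    (hq : G.Adj (f p) q)
    (hnew : ∀ a ∈ S, ∀ b ∈ S, H.Adj a b → c s(f a, f b) ≠ c s(f p, q)) (hκ : κ q = ι y) :
    IsRainbowOn G κ c H ι (insert y S) (Function.update f y q) := by
  have hold : ∀ {a}, a ∈ S → Function.update f y q a = f a := fun ha =>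
    Function.update_of_ne (by rintro rfl; exact hy ha) _ _
  have hself : Function.update f y q y = q := Function.update_self ..
  have key : ∀ {a b}, a ∈ insert y S → b ∈ insert y S → H.Adj a b →
      (a ∈ S ∧ b ∈ S) ∨ (s(a, b) = s(p, y) ∧
        s(Function.update f y q a, Function.update f y q b) = s(f p, q)) := by
    rintro a b (rfl | ha) (rfl | hb) hab
    · exact absurd rfl hab.ne
    · obtain rfl := huniq b hb hab.symm
      rw [hold hb, hself]
      exact Or.inr ⟨Sym2.eq_swap, Sym2.eq_swap⟩
    · obtain rfl := huniq a ha hab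
      rw [hold ha, hself]
      exact Or.inr ⟨rfl, rfl⟩
    · exact Or.inl ⟨ha, hb⟩
  refine ⟨?_, ?_, ?_⟩
  · intro a b ha hb hab
    rcases key ha hb hab with ⟨ha, hb⟩ | ⟨-, h⟩
    · rw [hold ha, hold hb]
      exact hf.adj ha hb hab
    · rw [← mem_edgeSet, h]
      exact hq
  · intro a b a' b' ha hb ha' hb' hab hab' h
    rcases key ha hb hab with ⟨ha, hb⟩ | ⟨e1, e2⟩ <;>
      rcases key ha' hb' hab' with ⟨ha', hb'⟩ | ⟨e1', e2'⟩
    · rw [hold ha, hold hb, hold ha', hold hb'] at h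
      exact hf.rainbow ha hb ha' hb' hab hab' h
    · rw [hold ha, hold hb, e2'] at h
      exact absurd h (hnew a ha b hb hab)
    · rw [hold ha', hold hb', e2] at h
      exact absurd h.symm (hnew a' ha' b' hb' hab')
    · rw [e1, e1']
  · rintro a (rfl | ha)
    · rw [hself, hκ]
    · rw [hold ha]
      exact hf.label ha

lemma IsRainbowOn.insert_of_not_adj [DecidableEq V] (hf : IsRainbowOn G κ c H ι S f) {y : V} {q : W}
    (hy : y ∉ S) (hadj : ∀ p ∈ S, ¬ H.Adj p y) (hκ : κ q = ι y) :
    IsRainbowOn G κ c H ι (insert y S) (Function.update f y q) := by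
  have hold : ∀ {a}, a ∈ S → Function.update f y q a = f a := fun ha =>
    Function.update_of_ne (by rintro rfl; exact hy ha) _ _
  have key : ∀ {a b}, a ∈ insert y S → b ∈ insert y S → H.Adj a b → a ∈ S ∧ b ∈ S := by
    rintro a b (rfl | ha) (rfl | hb) hab
    · exact absurd rfl hab.ne
    · exact absurd hab.symm (hadj b hb)
    · exact absurd hab (hadj a ha)
    · exact ⟨ha, hb⟩
  refine ⟨?_, ?_, ?_⟩
  · intro a b ha hb hab
    obtain ⟨ha, hb⟩ := key ha hb hab
    rw [hold ha, hold hb]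
    exact hf.adj ha hb hab
  · intro a b a' b' ha hb ha' hb' hab hab' h
    obtain ⟨ha, hb⟩ := key ha hb hab
    obtain ⟨ha', hb'⟩ := key ha' hb' hab'
    rw [hold ha, hold hb, hold ha', hold hb'] at h
    exact hf.rainbow ha hb ha' hb' hab hab' h
  · rintro a (rfl | ha)
    · rw [Function.update_self, hκ]
    · rw [hold ha]
      exact hf.label ha

/-- The greedy extension of a partial rainbow embedding of a forest with at most `k` edges. -/
lemma IsRainbowOn.exists_extension [Finite V] (hG : IsHost G κ k N nb) (hc : IsProperOn G c)
    (hH : H.IsAcyclic) (hι : ∀ {a b}, H.Adj a b → ι a = ι b) (hcard : H.edgeSet.ncard ≤ k)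
    (n : ℕ) : ∀ {S : Set V} {f : V → W}, Sᶜ.ncard = n → IsConnectedWithin H S →
      IsRainbowOn G κ c H ι S f →
      ∃ f', (∀ a ∈ S, f' a = f a) ∧ IsRainbowOn G κ c H ι Set.univ f' := by
  classical
  have := Fintype.ofFinite V
  induction n with
  | zero =>
    intro S f hn _ hf
    rw [Set.ncard_eq_zero, Set.compl_empty_iff] at hn
    subst hn
    exact ⟨f, fun _ _ => rfl, hf⟩
  | succ n ih =>
    intro S f hn hS hf
    have hne : S ≠ Set.univ := by
      rintro rfl
      simp at hn
    obtain ⟨y, hy, h⟩ := exists_adj_or_not_reachable H hne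
    have hncard : (insert y S)ᶜ.ncard = n := by
      have : (insert y S)ᶜ = Sᶜ \ {y} := by
        ext a
        simp only [Set.mem_compl_iff, Set.mem_insert_iff, Set.mem_sdiff, Set.mem_singleton_iff]
        tauto
      rw [this, Set.ncard_sdiff_singleton_of_mem (by exact hy), hn]
      rfl
    have hfin : ∀ q : W, IsConnectedWithin H (insert y S) →
        IsRainbowOn G κ c H ι (insert y S) (Function.update f y q) →
        ∃ f', (∀ a ∈ S, f' a = f a) ∧ IsRainbowOn G κ c H ι Set.univ f' := by
      intro q h1 h2
      obtain ⟨f', h3, h4⟩ := ih hncard h1 h2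
      refine ⟨f', fun a ha => ?_, h4⟩
      rw [h3 a (Or.inr ha), Function.update_of_ne]
      rintro rfl
      exact hy ha
    rcases h with ⟨p, hp, hpy⟩ | h
    -- Edges not yet embedded contribute arbitrary values of `f`; they are harmless, as only the
    -- size of `A`, at most `k - 1`, matters.
    · set A : Finset K := (H.edgeFinset.erase s(p, y)).image fun e => c (e.map f) with hA
      have hmem : s(p, y) ∈ H.edgeFinset := by simpa using hpy
      have hcard' : H.edgeFinset.card ≤ k := by
        rwa [Set.ncard_eq_toFinset_card', ← edgeFinset] at hcard
      obtain ⟨q, hq, hqA⟩ := hG.exists_adj_notMem hc (f p) A (Or.inl (by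
        refine Finset.card_image_le.trans_lt ?_
        have := Finset.card_erase_lt_of_mem hmem
        omega))
      refine hfin q (hS.insert_of_adj hp hpy) (hf.insert_of_adj hp hy hpy
        (fun p' hp' h' => hS.eq_of_adj hH hp hp' hy hpy h') hq ?_ ?_)
      · intro a ha b hb hab h
        apply hqA
        rw [← h, hA]
        refine Finset.mem_image.2 ⟨s(a, b), Finset.mem_erase.2 ⟨?_, by simpa using hab⟩, rfl⟩
        rw [Ne, Sym2.eq_iff]
        rintro (⟨-, rfl⟩ | ⟨rfl, -⟩)
        · exact hy hb
        · exact hy ha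
      · rw [← hG.label_eq hq, hf.label hp, hι hpy]
    · obtain ⟨q, hq⟩ := hG.exists_label (ι y)
      exact hfin q (hS.insert_of_not_reachable h)
        (hf.insert_of_not_adj hy (fun p hp h' => h p hp h'.reachable) hq)

/-- A rainbow homomorphism of a forest into a graph without short cycles is injective, if it keeps
the components apart. -/
lemma IsRainbowOn.injective [Fintype V] (hG : HasLongDetours G (Fintype.card V))
    (hι : ∀ {a b}, ι a = ι b → H.Reachable a b) (hf : IsRainbowOn G κ c H ι Set.univ f) :
    Function.Injective f := by
  classical
  intro a b hab
  by_contra hne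
  have hreach : H.Reachable a b := by
    apply hι
    rw [← hf.label (Set.mem_univ a), ← hf.label (Set.mem_univ b), hab]
  obtain ⟨p, hp⟩ := hreach.exists_isPath
  cases p with
  | nil => exact hne rfl
  | @cons _ a₁ _ h p =>
    set φ : H →g G := ⟨f, fun {u v} h => hf.adj (Set.mem_univ u) (Set.mem_univ v) h⟩ with hφ
    have hlen := hp.length_lt
    have hadj : G.Adj (f a₁) (f b) := hab ▸ (φ.map_adj h).symm
    -- If the image of the rest of the path contained the edge from `f a₁` to `f b = f a`, the
    -- rainbow property would make the path repeat its first edge.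
    have := hG hadj (p.map φ) (by
      intro hmem
      rw [Walk.edges_map, List.mem_map] at hmem
      obtain ⟨e, he, hee⟩ := hmem
      induction e with | _ u v
      have huv : H.Adj u v := p.adj_of_mem_edges he
      have hcol : c s(f u, f v) = c s(f a₁, f a) := by
        rw [hab]
        exact congrArg c hee
      have := hf.rainbow (Set.mem_univ u) (Set.mem_univ v) (Set.mem_univ a₁) (Set.mem_univ a) huv
        h.symm hcol
      have htrail := hp.isTrail
      rw [Walk.isTrail_cons] at htrail
      apply htrail.2
      rw [Sym2.eq_swap, ← this]
      exact he)
    rw [Walk.length_map] at this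
    rw [Walk.length_cons] at hlen
    omega

lemma exists_leaf [Finite V] (hH : H.IsAcyclic) (hne : H ≠ ⊥) :
    ∃ v l, H.Adj v l ∧ ∀ q, H.Adj q l → q = v := by
  classical
  have := Fintype.ofFinite V
  obtain ⟨a, b, hab⟩ := ne_bot_iff_exists_adj.1 hne
  set C := H.connectedComponentMk a with hC
  have hT : C.toSimpleGraph.IsTree := hH.isTree_connectedComponent C
  have hbC : b ∈ C.supp := ConnectedComponent.sound hab.symm.reachable
  have : Nontrivial C := ⟨⟨a, rfl⟩, ⟨b, hbC⟩, fun h => hab.ne (congrArg Subtype.val h)⟩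
  obtain ⟨⟨l, hl⟩, hdeg⟩ := hT.exists_vert_degree_one_of_nontrivial
  rw [degree_eq_one_iff_existsUnique_adj] at hdeg
  obtain ⟨⟨v, hv⟩, hlv, huniq⟩ := hdeg
  have hlv' : H.Adj l v := hlv
  refine ⟨v, l, hlv'.symm, fun q hq => ?_⟩
  have hqC : q ∈ C.supp := by
    have hl' : H.connectedComponentMk l = C := hl
    rw [ConnectedComponent.mem_supp_iff, ← hl']
    exact ConnectedComponent.sound hq.reachable
  have := huniq ⟨q, hqC⟩ (show H.Adj l q from hq.symm)
  exact congrArg Subtype.val this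

lemma isConnectedWithin_singleton (H : SimpleGraph V) (v : V) : IsConnectedWithin H {v} := by
  rintro a rfl b rfl _
  exact .refl _

/-- The union of a vertex and an edge, embedded such that the colour of the edge does not occur at
the image of the vertex. -/
lemma exists_isRainbowOn_seed (hG : IsHost G κ k N nb) (hc : IsProperOn G c) (hH : H.IsAcyclic)
    (hι : ∀ {a b}, H.Adj a b → ι a = ι b) {v u₀ w₀ : V} (huw : H.Adj u₀ w₀) (hu : u₀ ≠ v)
    (hw : w₀ ≠ v) : ∃ (S : Set V) (f : V → W) (u w : V), IsConnectedWithin H S ∧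
      IsRainbowOn G κ c H ι S f ∧ v ∈ S ∧ u ∈ S ∧ w ∈ S ∧ H.Adj u w ∧
      ¬ ColourAt G c (f v) (c s(f u, f w)) := by
  classical
  have hstart : ∀ x : W, κ x = ι v → IsRainbowOn G κ c H ι {v} fun _ => x := by
    intro x hx
    refine ⟨?_, ?_, ?_⟩
    · rintro a b rfl rfl h
      exact absurd rfl h.ne
    · rintro a b _ _ rfl rfl _ _ h
      exact absurd rfl h.ne
    · rintro a rfl
      exact hx
  have hv1 := isConnectedWithin_singleton H v
  -- Either a path `v u w` exists and is laid along `x y z`, where the colour of `yz` is absent at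
  -- `x`; or all edges in the component of `v` contain `v`, and `u₀w₀` lies in another component.
  by_cases hcase : ∃ u w, H.Adj v u ∧ H.Adj u w ∧ w ≠ v
  · obtain ⟨u, w, hvu, huw, hwv⟩ := hcase
    obtain ⟨x, y, α, hx, hxy, ⟨z, hyz, rfl⟩, hα⟩ := hG.exists_colourAt_ne (ι v) hc
    have hu : u ∉ ({v} : Set V) := by simpa using hvu.ne.symm
    have hw : w ∉ insert u ({v} : Set V) := by
      simpa using ⟨huw.ne.symm, hwv⟩
    have hyι : κ y = ι u := by rw [← hG.label_eq hxy, hx, hι hvu]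
    have h1 := (hstart x hx).insert_of_adj (q := y) rfl hu hvu (fun p' hp' _ => hp') hxy
      (by rintro a rfl b rfl h; exact absurd rfl h.ne) hyι
    have hv2 := hv1.insert_of_adj rfl hvu
    set f₁ := Function.update (fun _ : V => x) u y with hf₁
    have hf₁u : f₁ u = y := Function.update_self ..
    have hf₁v : f₁ v = x := Function.update_of_ne hvu.ne _ _
    have hnew : ∀ a ∈ insert u ({v} : Set V), ∀ b ∈ insert u ({v} : Set V), H.Adj a b →
        c s(f₁ a, f₁ b) ≠ c s(f₁ u, z) := by
      have hne : c s(x, y) ≠ c s(y, z) := fun h => hα ⟨y, hxy, h⟩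
      rintro a (rfl | rfl) b (rfl | rfl) h
      · exact absurd rfl h.ne
      · rw [hf₁u, hf₁v, Sym2.eq_swap]
        exact hne
      · rw [hf₁u, hf₁v]
        exact hne
      · exact absurd rfl h.ne
    have h2 := h1.insert_of_adj (q := z) (Or.inl rfl) hw huw
      (fun p' hp' h' => hv2.eq_of_adj hH (Or.inl rfl) hp' hw huw h') (by rw [hf₁u]; exact hyz)
      hnew (by rw [← hG.label_eq hyz, hyι, hι huw])
    refine ⟨_, _, u, w, hv2.insert_of_adj (Or.inl rfl) huw, h2, ?_, ?_, Or.inl rfl, huw, ?_⟩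
    · exact Or.inr (Or.inr rfl)
    · exact Or.inr (Or.inl rfl)
    · rw [Function.update_self, Function.update_of_ne huw.ne, Function.update_of_ne hwv.symm,
        hf₁u, hf₁v]
      exact hα
  · push Not at hcase
    have hnr : ¬ H.Reachable v u₀ := by
      intro hr
      obtain ⟨p, hp⟩ := hr.exists_isPath
      cases p with
      | nil => exact hu rfl
      | @cons _ v₁ _ h p =>
        cases p with
        | nil => exact hw (hcase _ _ h huw)
        | @cons _ v₂ _ h' p =>
          rw [Walk.cons_isPath_iff] at hp
          apply hp.2
          rw [← hcase _ _ h h', Walk.support_cons]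
          exact List.mem_cons_of_mem _ p.start_mem_support
    obtain ⟨x, hx⟩ := hG.exists_label (ι v)
    obtain ⟨y, z, hy, hyz, hα⟩ := hG.exists_adj_not_colourAt hc x (ι u₀)
    have hu' : u₀ ∉ ({v} : Set V) := by simpa using hu
    have hw' : w₀ ∉ insert u₀ ({v} : Set V) := by
      simpa using ⟨huw.ne.symm, hw⟩
    have h1 := (hstart x hx).insert_of_not_adj (q := y) hu'
      (by rintro p rfl h; exact hnr h.reachable) hy
    have hv2 : IsConnectedWithin H (insert u₀ {v}) :=
      hv1.insert_of_not_reachable (by rintro a rfl; exact hnr)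
    set f₁ := Function.update (fun _ : V => x) u₀ y with hf₁
    have hf₁u : f₁ u₀ = y := Function.update_self ..
    have hf₁v : f₁ v = x := Function.update_of_ne hu.symm _ _
    have h2 := h1.insert_of_adj (q := z) (Or.inl rfl) hw' huw
      (fun p' hp' h' => hv2.eq_of_adj hH (Or.inl rfl) hp' hw' huw h') (by rw [hf₁u]; exact hyz)
      (by
        rintro a (rfl | rfl) b (rfl | rfl) h
        · exact absurd rfl h.ne
        · exact absurd h.symm.reachable hnr
        · exact absurd h.reachable hnr
        · exact absurd rfl h.ne)
      (by rw [← hG.label_eq hyz, hy, hι huw])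
    refine ⟨_, _, u₀, w₀, hv2.insert_of_adj (Or.inl rfl) huw, h2, ?_, ?_, Or.inl rfl, huw, ?_⟩
    · exact Or.inr (Or.inr rfl)
    · exact Or.inr (Or.inl rfl)
    · rw [Function.update_self, Function.update_of_ne huw.ne, Function.update_of_ne hw.symm,
        hf₁u, hf₁v]
      exact hα

/-- A forest with `k + 1` edges which is not a star has a rainbow image in a host of degree `k`. -/
lemma exists_isRainbowOn_univ [Finite V] {F : SimpleGraph V} (hG : IsHost G κ k N nb)
    (hc : IsProperOn G c) (hF : F.IsAcyclic) (hι : ∀ {a b}, F.Adj a b → ι a = ι b)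
    (hcard : F.edgeSet.ncard = k + 1) (hstar : ¬ ∃ v, ∀ a b, F.Adj a b → a = v ∨ b = v) :
    ∃ f, IsRainbowOn G κ c F ι Set.univ f := by
  classical
  have := Fintype.ofFinite V
  have hne : F ≠ ⊥ := by
    rintro rfl
    simp at hcard
  obtain ⟨v, l, hvl, huniq⟩ := exists_leaf hF hne
  set H := F.deleteEdges {s(v, l)} with hH
  have hHF : H ≤ F := deleteEdges_le _
  have hHadj : ∀ {a b}, H.Adj a b ↔ F.Adj a b ∧ s(a, b) ≠ s(v, l) := by
    intro a b
    rw [hH, deleteEdges_adj, Set.mem_singleton_iff]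
  have hHcard : H.edgeSet.ncard = k := by
    rw [hH, edgeSet_deleteEdges, Set.ncard_sdiff_singleton_of_mem (F.mem_edgeSet.2 hvl), hcard]
    rfl
  push Not at hstar
  obtain ⟨u₀, w₀, huw, hu, hw⟩ := hstar v
  have huwH : H.Adj u₀ w₀ := by
    refine hHadj.2 ⟨huw, ?_⟩
    rw [Ne, Sym2.eq_iff]
    rintro (⟨h, -⟩ | ⟨-, h⟩)
    · exact hu h
    · exact hw h
  obtain ⟨S, f, u, w, hS, hf, hvS, huS, hwS, huw', hα⟩ := exists_isRainbowOn_seed hG hc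
    (hF.anti hHF) (fun h => hι (hHF h)) huwH hu hw
  obtain ⟨f', hff', hf'⟩ := hf.exists_extension hG hc (hF.anti hHF) (fun h => hι (hHF h))
    hHcard.le _ rfl hS
  rw [← hff' v hvS, ← hff' u huS, ← hff' w hwS] at hα
  set A : Finset K := H.edgeFinset.image fun e => c (e.map f') with hA
  have hmemA : ∀ {a b}, H.Adj a b → c s(f' a, f' b) ∈ A := fun {a b} hab =>
    Finset.mem_image.2 ⟨s(a, b), by simpa using hab, rfl⟩
  have hAcard : A.card ≤ k := by
    refine Finset.card_image_le.trans ?_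
    rw [Set.ncard_eq_toFinset_card', ← edgeFinset] at hHcard
    exact hHcard.le
  -- All `k` edges of `H` are embedded, but the colour of `uw` does not occur at `f' v`, so some
  -- edge there has a new colour. The isolated vertex `l` of `H` is then moved to the end of that
  -- edge.
  obtain ⟨q, hq, hqA⟩ := hG.exists_adj_notMem hc (f' v) A (Or.inr ⟨hAcard, _, hmemA huw', hα⟩)
  have hold : ∀ {a b}, a ∈ ({l}ᶜ : Set V) → b ∈ ({l}ᶜ : Set V) → F.Adj a b → H.Adj a b := by
    intro a b ha hb hab
    refine hHadj.2 ⟨hab, ?_⟩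
    rw [Ne, Sym2.eq_iff]
    rintro (⟨-, h⟩ | ⟨h, -⟩)
    · exact hb h
    · exact ha h
  have hF' : IsRainbowOn G κ c F ι {l}ᶜ f' := by
    refine ⟨fun ha hb hab => hf'.adj trivial trivial (hold ha hb hab), ?_,
      fun _ => hf'.label trivial⟩
    intro a b a' b' ha hb ha' hb' hab hab' h
    exact hf'.rainbow trivial trivial trivial trivial (hold ha hb hab) (hold ha' hb' hab') h
  have hfin := hF'.insert_of_adj (y := l) (q := q) hvl.ne (by simp) hvl
    (fun p' _ h => huniq p' h) hq
    (fun a ha b hb hab h => hqA (h ▸ hmemA (hold ha hb hab)))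
    (by rw [← hG.label_eq hq, hf'.label trivial, hι hvl])
  have huniv : insert l ({l}ᶜ : Set V) = Set.univ := by
    ext a
    simp [em]
  rw [huniv] at hfin
  exact ⟨_, hfin⟩

open Classical in
/-- The colours of a proper edge colouring as a function on all pairs of vertices. -/
noncomputable def extendColouring (c : ProperEdgeColouring G K) (e : Sym2 W) : Option K :=
  if h : e ∈ G.edgeSet then some (c ⟨e, h⟩) else none

lemma isProperOn_extendColouring (c : ProperEdgeColouring G K) :
    IsProperOn G (extendColouring c) := by
  intro x y z hxy hxz h
  rw [extendColouring, extendColouring, dif_pos (G.mem_edgeSet.2 hxy),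
    dif_pos (G.mem_edgeSet.2 hxz), Option.some.injEq] at h
  by_contra hne
  refine c.valid (lineGraph_adj_iff_exists.2 ⟨?_, x, ?_, ?_⟩) h
  · rw [Ne, Subtype.mk.injEq, Sym2.congr_right]
    exact hne
  · simp
  · simp

lemma IsRainbowOn.hasRainbowCopy {c : ProperEdgeColouring G K}
    (hf : IsRainbowOn G κ (extendColouring c) H ι Set.univ f) (hinj : Function.Injective f) :
    HasRainbowCopy H G c := by
  refine ⟨⟨⟨f, fun h => hf.adj trivial trivial h⟩, hinj⟩, ?_⟩
  rintro ⟨e, he⟩ ⟨e', he'⟩ h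
  induction e with | _ a b
  induction e' with | _ a' b'
  rw [Subtype.mk.injEq]
  refine hf.rainbow trivial trivial trivial trivial he he' ?_
  have h1 : s(f a, f b) ∈ G.edgeSet := hf.adj trivial trivial he
  have h2 : s(f a', f b') ∈ G.edgeSet := hf.adj trivial trivial he'
  rw [extendColouring, extendColouring, dif_pos h1, dif_pos h2]
  exact congrArg some h

lemma IsHost.maxDegree_le [Fintype W] [DecidableRel G.Adj] (hG : IsHost G κ k N nb) :
    G.maxDegree ≤ k := by
  classical
  refine maxDegree_le_of_forall_degree_le _ _ fun v => ?_
  rw [← card_neighborFinset_eq_degree]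
  calc (G.neighborFinset v).card ≤ (Finset.univ.image (nb v)).card := by
        refine Finset.card_le_card fun w hw => ?_
        rw [mem_neighborFinset, hG.adj_iff] at hw
        simpa using hw
    _ ≤ k := Finset.card_image_le.trans (by simp)

lemma forcedAtDegree_of_exists_isRainbowOn [Finite V] (F : SimpleGraph V) {k : ℕ} (hk : 2 ≤ k)
    (h : ∀ {W I K : Type} {G : SimpleGraph W} {κ : W → I} {nb : W → Fin k → W} {c : Sym2 W → K}
      {ι : V → I}, IsHost G κ k (Nat.card V) nb → IsProperOn G c →
      (∀ {a b}, F.Adj a b → ι a = ι b) → ∃ f, IsRainbowOn G κ c F ι Set.univ f) :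
    ForcedAtDegree F k := by
  classical
  have := Fintype.ofFinite V
  -- Components are numbered by `Fin` because labels live in `Type`, whereas `V` may lie in any
  -- universe. Detours of length `|V|` suffice for injectivity.
  obtain ⟨W, _, G, κ, nb, hG⟩ :=
    exists_isHost (Fin (Nat.card F.ConnectedComponent)) hk (Nat.card V)
  refine ⟨W, inferInstance, G, Classical.decRel _, hG.maxDegree_le, fun K c => ?_⟩
  obtain ⟨f, hf⟩ := h (ι := fun v => Finite.equivFin _ (F.connectedComponentMk v)) hG
    (isProperOn_extendColouring c)
    (fun hab => congrArg _ (ConnectedComponent.sound hab.reachable))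
  refine hf.hasRainbowCopy (hf.injective ?_ ?_)
  · rw [← Nat.card_eq_fintype_card]
    exact hG.hasLongDetours
  · intro a b hab
    exact ConnectedComponent.exact ((Finite.equivFin _).injective hab)

end Embedding

/-! ### The exceptional forests and the lower bounds. -/

section Exceptional

variable {V : Type*} {F : SimpleGraph V}

/-- A finite graph all of whose edges lie within the image of an injection is the disjoint union of
a graph on the source and of isolated vertices. -/
lemma exists_iso_sum_bot [Finite V] {T : Type*} {P : SimpleGraph T} (g : T → V)
    (hg : Function.Injective g) (hadj : ∀ s t, F.Adj (g s) (g t) ↔ P.Adj s t)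
    (hrange : ∀ x y, F.Adj x y → x ∈ Set.range g) :
    ∃ m, Nonempty (F ≃g P ⊕g (⊥ : SimpleGraph (Fin m))) := by
  classical
  set R : Set V := Set.range g with hR
  set e := (Finite.equivFin (Rᶜ : Set V)).symm
  set E := (Equiv.sumCongr (Equiv.ofInjective g hg) e).trans (Equiv.Set.sumCompl R) with hE
  have hl : ∀ s, E (.inl s) = g s := fun _ => rfl
  have hr : ∀ i, E (.inr i) = e i := fun _ => rfl
  have hnot : ∀ i y, ¬ F.Adj (e i : V) y := fun i y h => (e i).2 (hrange _ _ h)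
  refine ⟨Nat.card (Rᶜ : Set V), ⟨Iso.symm ⟨E, ?_⟩⟩⟩
  rintro (s | i) (t | j)
  · rw [hl, hl, hadj]
    simp
  · rw [hr]
    simpa using fun h => hnot _ _ h.symm
  · rw [hr]
    simpa using hnot _ _
  · rw [hr]
    exact iff_of_false (hnot _ _) fun h => h

lemma isStarWithIsolated_iff [Finite V] :
    IsStarWithIsolated F ↔ ∃ v, ∀ a b, F.Adj a b → a = v ∨ b = v := by
  classical
  constructor
  · rintro ⟨t, m, ⟨φ⟩⟩
    refine ⟨φ.symm (.inl 0), fun a b hab => ?_⟩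
    rw [← φ.map_adj_iff] at hab
    rw [RelIso.eq_symm_apply, RelIso.eq_symm_apply]
    generalize φ a = x at *
    generalize φ b = y at *
    rcases x with x | x <;> rcases y with y | y <;> simp_all
  · rintro ⟨v, hv⟩
    have hF : ∀ {a b}, F.Adj a b → a = v ∨ b = v := fun h => hv _ _ h
    obtain ⟨n, ⟨e⟩⟩ : ∃ n, Nonempty (Fin n ≃ F.neighborSet v) := ⟨_, ⟨(Finite.equivFin _).symm⟩⟩
    have hve : ∀ i, F.Adj v (e i) := fun i => (e i).2
    set g : Fin (n + 1) → V := Fin.cons v fun i => (e i : V)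
    have hg0 : g 0 = v := rfl
    have hgs : ∀ i, g (Fin.succ i) = e i := fun _ => rfl
    have hinj : Function.Injective g := by
      rw [Fin.cons_injective_iff]
      refine ⟨?_, fun i j h => e.injective (Subtype.ext h)⟩
      rintro ⟨i, hi⟩
      exact (hve i).ne hi.symm
    have hirr : ∀ i j, ¬ F.Adj (e i : V) (e j : V) := fun i j h => by
      rcases hF h with h | h
      · exact (hve i).ne h.symm
      · exact (hve j).ne h.symm
    have hadj : ∀ s t, F.Adj (g s) (g t) ↔ (starGraph (0 : Fin (n + 1))).Adj s t := by
      intro s t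
      rw [starGraph_adj]
      induction s using Fin.cases with
      | zero =>
        induction t using Fin.cases with
        | zero => simp
        | succ j => simpa [hg0, hgs, (Fin.succ_ne_zero j).symm] using hve j
      | succ i =>
        induction t using Fin.cases with
        | zero => simpa [hg0, hgs] using (hve i).symm
        | succ j => simpa [hgs] using hirr i j
    refine ⟨n, exists_iso_sum_bot g hinj hadj ?_⟩
    intro x y hxy
    rcases hF hxy with rfl | rfl
    · exact ⟨0, rfl⟩
    · exact ⟨(e.symm ⟨x, hxy.symm⟩).succ, by rw [hgs, Equiv.apply_symm_apply]⟩

lemma ncard_edgeSet_of_isTwoMatchingWithIsolated (h : IsTwoMatchingWithIsolated F) :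
    F.edgeSet.ncard = 2 := by
  obtain ⟨m, ⟨φ⟩⟩ := h
  have hφ : F.edgeSet = {s(φ.symm (.inl (.inl 0)), φ.symm (.inl (.inl 1))),
      s(φ.symm (.inl (.inr 0)), φ.symm (.inl (.inr 1)))} := by
    ext e
    induction e with | _ a b
    obtain ⟨x, rfl⟩ := φ.symm.surjective a
    obtain ⟨y, rfl⟩ := φ.symm.surjective b
    rw [mem_edgeSet, φ.symm.map_adj_iff, Set.mem_insert_iff, Set.mem_singleton_iff, Sym2.eq_iff,
      Sym2.eq_iff]
    simp only [φ.symm.injective.eq_iff]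
    rcases x with (x | x) | x <;> rcases y with (y | y) | y <;>
      simp <;> omega
  rw [hφ, Set.ncard_pair]
  rw [Ne, Sym2.eq_iff]
  simp [φ.symm.injective.eq_iff]

lemma isTwoMatchingWithIsolated_of_ncard_le_two [Finite V] [Nonempty V]
    (hstar : ¬ ∃ v, ∀ a b, F.Adj a b → a = v ∨ b = v) (hcard : F.edgeSet.ncard ≤ 2) :
    IsTwoMatchingWithIsolated F := by
  classical
  push Not at hstar
  obtain ⟨a, b, hab, -, -⟩ := hstar (Classical.arbitrary V)
  obtain ⟨x, y, hxy, hxa, hya⟩ := hstar a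
  -- With at most two edges in all, this edge avoiding `b` must be `xy`, so `xy` is disjoint from
  -- `ab`.
  obtain ⟨x', y', hxy', hxb, hyb⟩ := hstar b
  have hne : s(a, b) ≠ s(x, y) := by
    rw [Ne, Sym2.eq_iff]
    rintro (⟨h, -⟩ | ⟨h, -⟩)
    · exact hxa h.symm
    · exact hya h.symm
  have hedges : ({s(a, b), s(x, y)} : Set (Sym2 V)) = F.edgeSet := by
    refine Set.eq_of_subset_of_ncard_le ?_ (by rwa [Set.ncard_pair hne]) (Set.toFinite _)
    rintro e (rfl | rfl)
    · exact hab
    · exact hxy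
  have hadj : ∀ {u w}, F.Adj u w ↔ s(u, w) = s(a, b) ∨ s(u, w) = s(x, y) := by
    intro u w
    rw [← mem_edgeSet, ← hedges, Set.mem_insert_iff, Set.mem_singleton_iff]
  have hb : x ≠ b ∧ y ≠ b := by
    rcases hadj.1 hxy' with h | h <;> rcases Sym2.eq_iff.1 h with ⟨rfl, rfl⟩ | ⟨rfl, rfl⟩
    · exact absurd rfl hyb
    · exact absurd rfl hxb
    · exact ⟨hxb, hyb⟩
    · exact ⟨hyb, hxb⟩
  have h1 := hab.ne
  have h2 := hxy.ne
  refine exists_iso_sum_bot (Sum.elim ![a, b] ![x, y]) ?_ ?_ ?_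
  · rw [Sum.elim_injective]
    refine ⟨?_, ?_, ?_⟩
    · intro i j h
      fin_cases i <;> fin_cases j <;> simp_all
    · intro i j h
      fin_cases i <;> fin_cases j <;> simp_all
    · intro i j
      fin_cases i <;> fin_cases j <;> simp_all [eq_comm]
  · have key : ∀ {u w}, F.Adj u w ↔
        (u = a ∧ w = b ∨ u = b ∧ w = a) ∨ u = x ∧ w = y ∨ u = y ∧ w = x := by
      intro u w
      rw [hadj, Sym2.eq_iff, Sym2.eq_iff]
    rintro (i | i) (j | j) <;> rw [key] <;>
      fin_cases i <;> fin_cases j <;> simp_all [eq_comm]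
  · intro u w huw
    rcases hadj.1 huw with h | h <;> rcases Sym2.eq_iff.1 h with ⟨rfl, rfl⟩ | ⟨rfl, rfl⟩
    · exact ⟨.inl 0, rfl⟩
    · exact ⟨.inl 1, rfl⟩
    · exact ⟨.inr 0, rfl⟩
    · exact ⟨.inr 1, rfl⟩

/-- A star is rainbow in every proper edge colouring of itself. -/
lemma forcedAtDegree_of_star [Finite V] {v : V} (hv : ∀ a b, F.Adj a b → a = v ∨ b = v) :
    ForcedAtDegree F F.edgeSet.ncard := by
  classical
  have := Fintype.ofFinite V
  -- The star itself serves as the graph, transported to `Fin` since the witness must live in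
  -- `Type`.
  set G := F.overFin rfl with hG
  set φ : F ≃g G := F.overFinIso rfl with hφ
  refine ⟨Fin (Fintype.card V), inferInstance, G, Classical.decRel _, ?_, ?_⟩
  · refine maxDegree_le_of_forall_degree_le _ _ fun w => ?_
    have hcard : F.edgeSet.ncard = G.edgeFinset.card := by
      rw [Set.ncard_eq_toFinset_card', ← edgeFinset]
      exact φ.card_edgeFinset_eq
    rw [hcard, ← card_incidenceFinset_eq_degree]
    exact Finset.card_le_card (incidenceFinset_subset _ _)
  · intro K c
    refine ⟨φ.toCopy, fun e e' h => ?_⟩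
    by_contra hne
    have hmem : ∀ e : F.edgeSet, φ v ∈ (φ.toCopy.mapEdgeSet e : Sym2 _) := by
      rintro ⟨e, he⟩
      induction e with | _ a b
      have : φ v ∈ s(φ a, φ b) := by
        rcases hv a b he with rfl | rfl <;> simp
      exact this
    exact c.valid (lineGraph_adj_iff_exists.2 ⟨fun h => hne (φ.toCopy.mapEdgeSet.injective h),
      φ v, hmem e, hmem e'⟩) h

lemma ncard_edgeSet_le_of_star [Finite V] {v : V} (hv : ∀ a b, F.Adj a b → a = v ∨ b = v) {k : ℕ}
    (hk : ForcedAtDegree F k) : F.edgeSet.ncard ≤ k := by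
  classical
  have := Fintype.ofFinite V
  obtain ⟨W, _, G, _, hdeg, hrain⟩ := hk
  -- Any proper colouring will do, since only the existence of a copy is used.
  obtain ⟨f, -⟩ := hrain G.edgeSet (Coloring.mk id fun h => h.1)
  have hmem : ∀ e : F.edgeSet, f v ∈ (f.mapEdgeSet e : Sym2 W) := by
    rintro ⟨e, he⟩
    induction e with | _ a b
    have : f v ∈ s(f a, f b) := by
      rcases hv a b he with rfl | rfl <;> simp
    exact this
  calc F.edgeSet.ncard = (Finset.univ : Finset F.edgeSet).card := by
        rw [Finset.card_univ, ← Nat.card_eq_fintype_card]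
        rfl
    _ ≤ (G.incidenceFinset (f v)).card := by
        refine Finset.card_le_card_of_injOn (fun e => (f.mapEdgeSet e : Sym2 W)) ?_ ?_
        · intro e _
          rw [Finset.mem_coe, mem_incidenceFinset]
          exact ⟨(f.mapEdgeSet e).2, hmem e⟩
        · intro e _ e' _ h
          exact f.mapEdgeSet.injective (Subtype.ext h)
    _ ≤ k := by
        rw [card_incidenceFinset_eq_degree]
        exact (G.degree_le_maxDegree _).trans hdeg

lemma HasRainbowCopy.ncard_le [Finite V] {W K : Type*} [Fintype K] {G : SimpleGraph W}
    {c : ProperEdgeColouring G K} (h : HasRainbowCopy F G c) :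
    F.edgeSet.ncard ≤ Fintype.card K := by
  obtain ⟨f, hf⟩ := h
  rw [← Nat.card_eq_fintype_card]
  exact Nat.card_le_card_of_injective _ hf

lemma ncard_edgeSet_le_succ [Finite V] {k : ℕ} (hk : ForcedAtDegree F k) :
    F.edgeSet.ncard ≤ k + 1 := by
  classical
  obtain ⟨W, _, G, _, hdeg, hrain⟩ := hk
  obtain ⟨c⟩ := nonempty_properEdgeColouring (K := Fin (k + 1)) G fun v => by
    have := G.degree_le_maxDegree v
    simp only [Fintype.card_fin]
    omega
  simpa using (hrain _ c).ncard_le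

lemma two_le_of_forcedAtDegree [Finite V] (hF : F.edgeSet.ncard = 2) {k : ℕ}
    (hk : ForcedAtDegree F k) : 2 ≤ k := by
  classical
  by_contra! hlt
  obtain ⟨W, _, G, _, hdeg, hrain⟩ := hk
  have hc : ∀ {e e' : G.edgeSet}, ¬ G.lineGraph.Adj e e' := by
    intro e e' h
    obtain ⟨hne, v, hv, hv'⟩ := lineGraph_adj_iff_exists.1 h
    have h1 : (G.incidenceFinset v).card ≤ 1 := by
      rw [card_incidenceFinset_eq_degree]
      have := G.degree_le_maxDegree v
      omega
    rw [Finset.card_le_one] at h1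
    exact hne (Subtype.ext (h1 _ (by rw [mem_incidenceFinset]; exact ⟨e.2, hv⟩) _
      (by rw [mem_incidenceFinset]; exact ⟨e'.2, hv'⟩)))
  have := (hrain Unit (Coloring.mk (fun _ => ()) fun h => absurd h hc)).ncard_le
  simp [hF] at this

end Exceptional

end DegreeAntiRamsey

/-! ### The theorem. -/

open DegreeAntiRamsey in
/-- The degree anti-Ramsey number of a forest `F` is `e(F) - 1`, unless `F` is, up to isolated
vertices, a star or a matching with precisely two edges, in which case it is `e(F)`. (A forest
which is not exceptional has at least three edges, so the subtraction is never truncated.) -/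
theorem theorem3 {V : Type*} [Finite V] [Nonempty V] (F : SimpleGraph V) (hF : F.IsAcyclic) :
    (¬ (IsStarWithIsolated F ∨ IsTwoMatchingWithIsolated F) →
      IsDegreeAntiRamseyNumber F (F.edgeSet.ncard - 1)) ∧
    ((IsStarWithIsolated F ∨ IsTwoMatchingWithIsolated F) →
      IsDegreeAntiRamseyNumber F F.edgeSet.ncard) := by
  constructor
  · intro h
    rw [not_or, isStarWithIsolated_iff] at h
    have h3 : 3 ≤ F.edgeSet.ncard := by
      by_contra! hlt
      exact h.2 (isTwoMatchingWithIsolated_of_ncard_le_two h.1 (by omega))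
    refine ⟨forcedAtDegree_of_exists_isRainbowOn F (by omega) fun hG hc hι =>
      exists_isRainbowOn_univ hG hc hF hι (by omega) h.1, fun k hk => ?_⟩
    have := ncard_edgeSet_le_succ hk
    omega
  · rintro (h | h)
    · obtain ⟨v, hv⟩ := isStarWithIsolated_iff.1 h
      exact ⟨forcedAtDegree_of_star hv, fun k hk => ncard_edgeSet_le_of_star hv hk⟩
    · have h2 := ncard_edgeSet_of_isTwoMatchingWithIsolated h
      refine ⟨?_, fun k hk => ?_⟩
      · rw [h2]
        -- Here the degree equals `e(F)`, so the greedy extension from the empty set already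
        -- suffices.
        refine forcedAtDegree_of_exists_isRainbowOn F le_rfl
          fun {W I K G κ nb c ι} hG hc hι => ?_
        obtain ⟨x, -⟩ := hG.exists_label (ι (Classical.arbitrary V))
        have hstart : IsRainbowOn G κ c F ι ∅ fun _ => x :=
          ⟨fun h => h.elim, fun h => h.elim, fun h => h.elim⟩
        obtain ⟨f, -, hf⟩ := hstart.exists_extension hG hc hF hι h2.le _ rfl
          (fun a ha => ha.elim)
        exact ⟨f, hf⟩
      · rw [h2]
        exact two_le_of_forcedAtDegree h2 hk
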